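/- **Robots.** $n$ anonymous, oblivious robots are points of $\mathbb R^2$. They act in synchronous Look-Compute-Move (LCM) cycles. In each cycle every robot sees the set of positions of the robots at distance at most $1$, in its own local coordinate system, which is centred at the robot, has the common unit length and handedness, and is rotated arbitrarily (differently for each robot and each cycle). From this snapshot alone a deterministic protocol computes a target point at distance at most $1$, to which the robot moves. **Pattern.** Let $P\subset\mathbb R^2$ be a finite pattern whose smallest enclosing circle is centred at the origin. Its symmetricity $s_P$ is the largest $m$ such that $P$ can be partitioned into regular $m$-gons centred at the origin (single points for $m=1$). Write $\angle(u,w)\in[0,2\pi)$ for the counterclockwise angle from $u$ to $w$ (with $\angle(u,0)=0$) and $\vec e_x=(1,0)$. For $1\le i\le s_P$ let $C^{(i)}=\{p:\angle(\vec e_x,p)\in[(i-1)\tfrac{2\pi}{s_P},i\tfrac{2\pi}{s_P})\}$, $P^{(i)}=P\cap C^{(i)}$, and let $\rho_i$ be the rotation about the origin by $(i-1)\tfrac{2\pi}{s_P}$. **Drawing formations.** A drawing hull has an anchor $a$, a unit direction $\vec d$, a span $\phi\in(0,\pi/3]$ and a diameter $\Delta\in(0,1]$; it is the point set $\{x: |x-a|\le\Delta,\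 \angle(\vec d,x-a)\in[0,\phi)\}$. The robots in a hull $H$ form a drawing formation $F$; its state is the set of their positions. Let $\epsilon>0$ and let $\vec d_\perp$ be $\vec d$ turned counterclockwise by $\pi/2$. The $\epsilon$-granular locations are the points of $\{a\}\cup\{a+(1+2i)\epsilon\vec d+2j\epsilon\vec d_\perp: i,j\in\mathbb N_0\}$ in $H$; an $\epsilon$-granular state is the union of a set of such locations with a set $\{a,a+\epsilon\vec d,a+(1+2i)\epsilon\vec d\}$, $1\le i\le\lfloor(\Delta/\epsilon-1)/2\rfloor$. $A_F^\ell(\epsilon)$ is the set of the $\epsilon$-granular states with $\ell$ points. An arbitrary enumeration of each $A_F^\ell(\epsilon)$ by $1,2,\dots$ that is invariant under rigid motions is fixed; a formation of size $\ell$ is in state $i$ if its state is the $i$-th element of $A_F^\ell(\epsilon)$. An $\epsilon$-granular initial drawing pattern for $P$ is a configuration of $|P|$ robots, each of which belongs to one of $s_P$ $\epsilon$-granular drawing formations $F^{(1)},\dots,F^{(s_P)}$, all in state $1$, where $F^{(1)}$ has diameter $\Delta\le 1/6$, direction $\vec e_x$, span $\min\{2\pi/s_P,\pi/3\}$ and its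 anchor at the point with polar coordinates $(2\Delta,\pi/s_P)$, and $F^{(i)}=\rho_i(F^{(1)})$. **Drawing paths.** A $\delta$-drawing path of a pattern $Q$ is a sequence $\boldsymbol v=(v_1,\dots,v_k)$ of points such that every $p\in Q$ has distance at most $1-\delta$ from some vertex, and $|v_j-v_{j+1}|\le1-\delta$ for $1\le j<k$. $\operatorname{cov}(v_j)$ is the set of those $p\in Q$ for which $j$ is the largest index with $|p-v_j|\le1-\delta$. The tail is the longest suffix $(v_j)_{j=a}^k$ with $\sum_{j=a}^k|\operatorname{cov}(v_j)|<4$; $\operatorname{cov}$ of a set of vertices is the union. An $\epsilon$-granular formation $F$ of diameter $\Delta$ is compatible with $\boldsymbol v$ if (1) any two distinct points of $Q$ have distance $>\epsilon$, and $\Delta\le\delta$; (2) $b-a\le|A_F^4(\epsilon)|$ for all $1\le a<b\le k$ with $\bigcup_{j=a}^{b-1}\operatorname{cov}(v_j)=\emptyset$; (3) the tail has at most $|A_F^3(\epsilon)|$ vertices; (4) $|\operatorname{cov}(\text{tail})|=3$, and $\operatorname{cov}(\text{tail})$ lies in the closed unit ball around $v_k$. **Lemma.** There is an absolute constant $C$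 with the following property. Let $P$, $\epsilon>0$, a state enumeration and the hull of $F^{(1)}$ be as above. Let $\boldsymbol v=(v_1,\dots,v_k)$ be a $\delta$-drawing path of $P^{(1)}$ that is compatible with $F^{(1)}$, starts in the anchor of $F^{(1)}$, lies in $C^{(1)}$, and all of whose vertices have distance $>\max\{\epsilon,\Delta\sin(2\pi/s_P)\}$ from every point of the boundary $\partial C^{(1)}$. Then there are a protocol and a number of cycles $T$ with $k\le T\le C\cdot k$ such that, started in any $\epsilon$-granular initial drawing pattern for $P$ with these parameters, and for all rotations of the local coordinate systems: 1. After $T$ cycles $P$ is formed, with exactly one robot at each point of $P$; if any two distinct points of $P$ have distance $>\epsilon$, then no robot ever moves again. 2. Every $F^{(i)}$ draws $P^{(i)}$ along $\rho_i(\boldsymbol v)$. After $j-1$ cycles ($1\le j\le k$) its robots that are not yet dropped lie in its hull, translated to the anchor $\rho_i(v_j)$. When leaving a vertex $v_j$, $j<k$, that is not in the tail, it drops exactly one robot at each point of $\rho_i(\operatorname{cov}(v_j))$, and on the tail it drops none before the end; dropped robots do not move until cycle $T$. After $T$ cycles its last robots occupy $\rho_i(\operatorname{cov}(\text{tail}))$,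 one at each point, so that its robots occupy $P^{(i)}$, one at each point. 3. The formations do not interfere: after $j-1$ cycles ($1\le j\le k$) the hulls of the $F^{(i)}$, anchored at $\rho_i(v_j)$, are pairwise disjoint, and no hull contains a robot, dropped or not, that belonged to another formation at the start. -/

import Mathlib

/-! The plane `ℝ²` is modelled as `ℂ`, so that `(1, 0)` is `1`, and turning a vector counterclockwise
by an angle is multiplication by a unit complex number (an element of `Circle`). -/

namespace Drawing

/-- The counterclockwise angle from `u` to `w`, in `[0, 2π)`; it is `0` if `w = 0`. -/
noncomputable def ccwAngle (u w : ℂ) : ℝ :=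
  toIcoMod Real.two_pi_pos 0 (Complex.arg (w / u))

/-! ### Robots: oblivious, disoriented, synchronous, viewing range `1` -/

/-- A deterministic oblivious protocol: from the snapshot that a robot takes in its own local
coordinate system (itself at the origin) it computes the displacement of the robot in that same
coordinate system. A robot moves a distance of at most `1` per cycle. -/
structure Protocol where
  move : Set ℂ → ℂ
  norm_move_le : ∀ S, ‖move S‖ ≤ 1

section Execution

variable {ι : Type}

/-- What robot `r` sees in configuration `R`: the positions of all robots at distance at most `1`,
in the coordinate system centred at `r` and rotated by `u` against the global one.
The robots are anonymous, hence the snapshot is just a set of points. -/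
def snapshot (R : ι → ℂ) (r : ι) (u : Circle) : Set ℂ :=
  {z | ∃ r', dist (R r') (R r) ≤ 1 ∧ (u : ℂ) * z = R r' - R r}

/-- One synchronous Look-Compute-Move cycle; robot `r` uses a local frame rotated by `u r`. -/
def Protocol.step (A : Protocol) (u : ι → Circle) (R : ι → ℂ) : ι → ℂ :=
  fun r => R r + (u r : ℂ) * A.move (snapshot R r (u r))

/-- The configuration after `t` cycles, started in `R`, where in cycle `t` the (arbitrary) local
frame of robot `r` is rotated by `u t r`. -/
def Protocol.run (A : Protocol) (u : ℕ → ι → Circle) (R : ι → ℂ) : ℕ → ι → ℂ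
  | 0 => R
  | t + 1 => A.step (u t) (A.run u R t)

end Execution

/-! ### Symmetricity, cones, symmetric components -/

/-- `c` is the centre of the smallest enclosing circle of `P`. -/
def IsEnclosingCenter (P : Set ℂ) (c : ℂ) : Prop :=
  ∃ r : ℝ, P ⊆ Metric.closedBall c r ∧
    ∀ (c' : ℂ) (r' : ℝ), P ⊆ Metric.closedBall c' r' → r ≤ r'

/-- `P` is partitioned into regular `m`-gons with common centre `c`: the rotation by `2π/m` about `c`
preserves `P` and, if `m > 1`, the point `c` (a degenerate `m`-gon) is not in `P`. For `m = 1` this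
is always true: a single point is a `1`-gon. -/
def HasRegularPartition (P : Set ℂ) (c : ℂ) (m : ℕ) : Prop :=
  1 ≤ m ∧ ∀ p ∈ P, (1 < m → p ≠ c) ∧
    c + (Circle.exp (2 * Real.pi / m) : ℂ) * (p - c) ∈ P

/-- `s` is the symmetricity of the pattern `P`. -/
def IsSymmetricity (P : Set ℂ) (s : ℕ) : Prop :=
  ∃ c, IsEnclosingCenter P c ∧ IsGreatest {m | HasRegularPartition P c m} s

/-- The `i`-th cone (`1 ≤ i ≤ s`). -/
def cone (s i : ℕ) : Set ℂ :=
  {p | ccwAngle 1 p ∈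
    Set.Ico (((i : ℝ) - 1) * (2 * Real.pi / s)) ((i : ℝ) * (2 * Real.pi / s))}

/-- The `i`-th symmetric component of `P`. -/
def component (P : Set ℂ) (s i : ℕ) : Set ℂ := P ∩ cone s i

/-- The rotation about the origin by `(i - 1) · 2π/s`. -/
noncomputable def rotor (s i : ℕ) : Circle :=
  Circle.exp (((i : ℝ) - 1) * (2 * Real.pi / s))

/-! ### Drawing hulls and drawing formations -/

structure DrawingHull where
  anchor : ℂ
  dir : ℂ
  span : ℝ
  diam : ℝ
  norm_dir : ‖dir‖ = 1
  span_mem : span ∈ Set.Ioc 0 (Real.pi / 3)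
  diam_mem : diam ∈ Set.Ioc (0 : ℝ) 1

namespace DrawingHull

/-- The point set of a drawing hull. -/
def carrier (H : DrawingHull) : Set ℂ :=
  {x | dist x H.anchor ≤ H.diam ∧ ccwAngle H.dir (x - H.anchor) ∈ Set.Ico 0 H.span}

/-- The image of the hull under the rigid motion `z ↦ w * z + b`. -/
def rigid (H : DrawingHull) (w : Circle) (b : ℂ) : DrawingHull where
  anchor := w * H.anchor + b
  dir := w * H.dir
  span := H.span
  diam := H.diam
  norm_dir := by rw [norm_mul, Circle.norm_coe, one_mul, H.norm_dir]
  span_mem := H.span_mem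
  diam_mem := H.diam_mem

/-- The hull with the same direction, span and diameter that is anchored at `p`. -/
def moveTo (H : DrawingHull) (p : ℂ) : DrawingHull := { H with anchor := p }

/-- The state robots of the drawing formation with hull `H` in configuration `R`. -/
def robots {ι : Type} (H : DrawingHull) (R : ι → ℂ) : Set ι := {r | R r ∈ H.carrier}

/-- The state of the drawing formation with hull `H` in configuration `R`. -/
def state {ι : Type} (H : DrawingHull) (R : ι → ℂ) : Set ℂ := R '' H.robots R

/-- The `ε`-granular locations. -/
def locations (H : DrawingHull) (ε : ℝ) : Set ℂ :=
  ({H.anchor} ∪ {z | ∃ i j : ℕ, z = H.anchor + ((1 + 2 * (i : ℝ)) * ε : ℝ) * H.dir +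
    (2 * (j : ℝ) * ε : ℝ) * (Complex.I * H.dir)}) ∩ H.carrier

/-- The possible placements of the three defining robots. -/
def definingSets (H : DrawingHull) (ε : ℝ) : Set (Set ℂ) :=
  {T | ∃ i ∈ Finset.Icc 1 ⌊(H.diam / ε - 1) / 2⌋₊,
    T = {H.anchor, H.anchor + (ε : ℂ) * H.dir,
      H.anchor + ((1 + 2 * (i : ℝ)) * ε : ℝ) * H.dir}}

/-- The `ε`-granular states. -/
def granularStates (H : DrawingHull) (ε : ℝ) : Set (Set ℂ) :=
  {U | ∃ S T : Set ℂ, S ⊆ H.locations ε ∧ T ∈ H.definingSets ε ∧ U = S ∪ T}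

/-- The `ε`-granular states that can be adopted with `ℓ` state robots. -/
def granularStatesOfSize (H : DrawingHull) (ε : ℝ) (ℓ : ℕ) : Set (Set ℂ) :=
  {U ∈ H.granularStates ε | U.ncard = ℓ}

end DrawingHull

/-- An enumeration of the `ε`-granular states of each size `ℓ` by `1, 2, …` that depends only
on the relative position of the locations (it is compatible with rigid motions). -/
structure StateEnum (ε : ℝ) where
  nth : DrawingHull → ℕ → ℕ → Set ℂ
  bijOn : ∀ (H : DrawingHull) (ℓ : ℕ),
    Set.BijOn (nth H ℓ) (Set.Icc 1 (H.granularStatesOfSize ε ℓ).ncard)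
      (H.granularStatesOfSize ε ℓ)
  nth_rigid : ∀ (H : DrawingHull) (w : Circle) (b : ℂ) (ℓ : ℕ),
    ∀ i ∈ Set.Icc 1 (H.granularStatesOfSize ε ℓ).ncard,
      nth (H.rigid w b) ℓ i = (fun z => (w : ℂ) * z + b) '' nth H ℓ i

/-- The drawing formation with hull `H` in configuration `R` is in the `i`-th state of its size. -/
def StateEnum.InState {ε : ℝ} (e : StateEnum ε) {ι : Type} (H : DrawingHull) (R : ι → ℂ)
    (i : ℕ) : Prop :=
  i ∈ Set.Icc 1 (H.granularStatesOfSize ε (H.robots R).ncard).ncard ∧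
    H.state R = e.nth H (H.robots R).ncard i

/-- The hull is aligned with the `i`-th symmetric component of a pattern of symmetricity `s`. -/
def IsAligned (H : DrawingHull) (s i : ℕ) : Prop :=
  ccwAngle 1 H.dir = ((i : ℝ) - 1) * (2 * Real.pi / s) ∧
    H.span = min (2 * Real.pi / s) (Real.pi / 3)

/-- The hull of the `i`-th of the `s` drawing formations, of which the first has hull `H`. -/
noncomputable def formationHull (H : DrawingHull) (s i : ℕ) : DrawingHull :=
  H.rigid (rotor s i) 0

/-- `R` is an `ε`-granular initial drawing pattern for `P` (of symmetricity `s`), where `H` is the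
hull of the first drawing formation. -/
structure IsInitialDrawingPattern {ε : ℝ} (e : StateEnum ε) (P : Finset ℂ) (s : ℕ)
    (H : DrawingHull) (R : Fin P.card → ℂ) : Prop where
  diam_le : H.diam ≤ 1 / 6
  aligned : IsAligned H s 1
  anchor_eq : H.anchor = (2 * H.diam : ℝ) * (Circle.exp (Real.pi / s) : ℂ)
  rotated : ∀ i ∈ Finset.Icc 1 s,
    (formationHull H s i).state R = (fun z => (rotor s i : ℂ) * z) '' H.state R
  mem_formation : ∀ r, ∃ i ∈ Finset.Icc 1 s, r ∈ (formationHull H s i).robots R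
  granular : ∀ i ∈ Finset.Icc 1 s,
    (formationHull H s i).state R ∈ (formationHull H s i).granularStates ε
  state_one : ∀ i ∈ Finset.Icc 1 s, e.InState (formationHull H s i) R 1

/-! ### Drawing paths. A path `v₁, …, v_k` is a function `v : ℕ → ℂ`, of which only the values
at `1, …, k` matter. -/

/-- `v₁, …, v_k` is a `δ`-drawing path of `P`. -/
def IsDrawingPath (δ : ℝ) (P : Set ℂ) (k : ℕ) (v : ℕ → ℂ) : Prop :=
  (∀ p ∈ P, ∃ j ∈ Finset.Icc 1 k, dist p (v j) ≤ 1 - δ) ∧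
    ∀ j, 1 ≤ j → j < k → dist (v j) (v (j + 1)) ≤ 1 - δ

/-- The coordinates of `P` covered by the vertex `v j`. -/
def cov (δ : ℝ) (P : Set ℂ) (k : ℕ) (v : ℕ → ℂ) (j : ℕ) : Set ℂ :=
  {p ∈ P | dist p (v j) ≤ 1 - δ ∧ ∀ j', j < j' → j' ≤ k → 1 - δ < dist p (v j')}

/-- The index of the first vertex of the tail, the longest suffix that covers less than four
coordinates (it is `k + 1` if the tail is empty). -/
noncomputable def tailStart (δ : ℝ) (P : Set ℂ) (k : ℕ) (v : ℕ → ℂ) : ℕ :=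
  sInf {a | 1 ≤ a ∧ ∑ j ∈ Finset.Icc a k, (cov δ P k v j).ncard < 4}

/-- The coordinates covered by the tail. -/
def covTail (δ : ℝ) (P : Set ℂ) (k : ℕ) (v : ℕ → ℂ) : Set ℂ :=
  ⋃ j ∈ Finset.Icc (tailStart δ P k v) k, cov δ P k v j

/-- Any two distinct points of `P` have distance more than `ε`. -/
def MindistGt (ε : ℝ) (P : Set ℂ) : Prop :=
  ∀ p ∈ P, ∀ q ∈ P, p ≠ q → ε < dist p q

/-- An `ε`-granular drawing formation with hull `H` is compatible with the `δ`-drawing path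
`v₁, …, v_k` of `P`. -/
structure Compatible (ε : ℝ) (H : DrawingHull) (δ : ℝ) (P : Set ℂ) (k : ℕ) (v : ℕ → ℂ) :
    Prop where
  mindist : MindistGt ε P
  diam_le : H.diam ≤ δ
  body : ∀ a b, 1 ≤ a → a < b → b ≤ k → (⋃ j ∈ Finset.Ico a b, cov δ P k v j) = ∅ →
    b - a ≤ (H.granularStatesOfSize ε 4).ncard
  tail : k + 1 - tailStart δ P k v ≤ (H.granularStatesOfSize ε 3).ncard
  covTail_card : (covTail δ P k v).ncard = 3
  covTail_subset : covTail δ P k v ⊆ Metric.closedBall (v k) 1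

/-! ### Drawing a component -/

/-- In the execution `X` the drawing formation with hull `H` at time `0` draws its pattern `Q` along
the path `v₁, …, v_k` until time `T`; here `D j` is the set of its robots that are
not yet dropped when the formation is at `v j`, that is, at time `j - 1`.
* It takes one edge per cycle: at time `j - 1` the robots in `D j` are in the hull anchored at `v j`.
* When it leaves a vertex `v j` before the tail, one robot is dropped at each coordinate
  covered by `v j`. On the tail no robot is dropped before the end. Dropped robots stay where they
  are.
* At time `T` the last robots are at the coordinates that the tail covers, and thus all
  robots are at the coordinates of `Q`, one robot at each. -/
structure Draws {ι : Type} (X : ℕ → ι → ℂ) (H : DrawingHull) (δ : ℝ) (Q : Set ℂ) (k : ℕ)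
    (v : ℕ → ℂ) (T : ℕ) (D : ℕ → Set ι) : Prop where
  init : D 1 = H.robots (X 0)
  mem_hull : ∀ j ∈ Finset.Icc 1 k, ∀ r ∈ D j, X (j - 1) r ∈ (H.moveTo (v j)).carrier
  anti : ∀ j, 1 ≤ j → j < k → D (j + 1) ⊆ D j
  drop : ∀ j, 1 ≤ j → j < k → j < tailStart δ Q k v →
    Set.BijOn (X j) (D j \ D (j + 1)) (cov δ Q k v j)
  keep : ∀ j, 1 ≤ j → j < k → tailStart δ Q k v ≤ j → D (j + 1) = D j
  stay : ∀ j, 1 ≤ j → j < k → ∀ r ∈ D j \ D (j + 1), ∀ t, j ≤ t → t ≤ T → X t r = X j r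
  last : Set.BijOn (X T) (D k) (covTail δ Q k v)
  formed : Set.BijOn (X T) (H.robots (X 0)) Q

/-- The `s` drawing formations, of which the `i`-th has hull `H i` at time `0` and moves along the
path `v i 1, …, v i k`, do not interfere: while they move, their hulls are pairwise disjoint, and no
hull contains a robot, dropped or not, of another drawing formation. -/
def NonInterfering {ι : Type} (X : ℕ → ι → ℂ) (H : ℕ → DrawingHull) (s k : ℕ)
    (v : ℕ → ℕ → ℂ) : Prop :=
  ∀ j ∈ Finset.Icc 1 k, ∀ i ∈ Finset.Icc 1 s, ∀ i' ∈ Finset.Icc 1 s, i ≠ i' →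
    Disjoint ((H i).moveTo (v i j)).carrier ((H i').moveTo (v i' j)).carrier ∧
    ∀ r ∈ (H i').robots (X 0), X (j - 1) r ∉ ((H i).moveTo (v i j)).carrier

end Drawing

/-! A protocol may be any function of the snapshot. So it suffices to prescribe trajectories with
steps of length at most 1 along which robots with the same snapshot, up to rotation, make the same
move in local coordinates; the resulting look-up table is the protocol (`Drawing.exists_protocol`).
The task is to choose trajectories on which a moving robot can read off the time, its role and its
orientation, up to the rotations that permute the formations. The state numbering only fixes the
start: every formation has size |P|/s, so "state 1" is the same state in all initial patterns and
one table serves them all (`exists_tour`).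

After the first cycle the grid is abandoned. At the times 1, ..., k the robots not yet dropped form
a cluster much smaller than ε: one head at distance `size t` from the centre, the others within a
tenth of that. A cluster determines its head and has no rotational symmetry about it
(`IsHead.unique`, `IsHead.eq_one`). Since sizes at least halve from one time to the next, distances
to the head encode the time. Hence equal snapshots give equal moves
(`Choreography.consistent_cluster`). The initial configuration is visible as a whole, and within it
only an anchor and its nearest grid neighbour are at distance ε, which fixes all roles
(`Choreography.consistent_initial`). Its distances are at least ε, so it is not mistaken for a later
one; a final pattern with distances above ε is not mistaken for an earlier configuration either
(`Choreography.not_matches_of_lt_dist`).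

The geometry is collected in `Tour.Valid`. Path vertices lie deeper than ε in their cone, hence so
do the hulls, and different formations stay apart. A point is occupied from the last vertex that
reaches it, so later clusters avoid it. A move costs at most Δ inside the hull plus 1 - δ along an
edge or to a goal. Points of the tail may be at distance 1 from the last vertex, so one extra cycle
there shifts each robot towards its goal; thus T = k + 1. -/

namespace Drawing

/-! ### Angles, cones and rotations -/

lemma ccwAngle_mul_left {w : ℂ} (hw : w ≠ 0) (u z : ℂ) :
    ccwAngle (w * u) (w * z) = ccwAngle u z := by
  unfold ccwAngle
  rw [mul_div_mul_left _ _ hw]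

lemma ccwAngle_mem (u z : ℂ) : ccwAngle u z ∈ Set.Ico 0 (2 * Real.pi) := by
  have := toIcoMod_mem_Ico Real.two_pi_pos 0 (Complex.arg (z / u))
  rwa [zero_add] at this

lemma norm_mul_exp_ccwAngle (z : ℂ) :
    (‖z‖ : ℂ) * (Circle.exp (ccwAngle 1 z) : ℂ) = z := by
  obtain ⟨n, hn⟩ := ((toIcoMod_eq_iff Real.two_pi_pos (a := 0) (b := Complex.arg (z / 1))
    (c := ccwAngle 1 z)).1 rfl).2
  have h : ccwAngle 1 z = Complex.arg z - n • (2 * Real.pi) := by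
    rw [div_one] at hn
    rw [hn]; ring
  have h2 : Circle.exp (ccwAngle 1 z) = Circle.exp (Complex.arg z) := by
    rw [h, zsmul_eq_mul]
    exact Circle.periodic_exp.sub_int_mul_eq n
  rw [h2, Circle.coe_exp, Complex.norm_mul_exp_arg_mul_I]

lemma ccwAngle_one_eq {r θ : ℝ} (hr : 0 < r) (hθ : θ ∈ Set.Ico 0 (2 * Real.pi)) :
    ccwAngle 1 ((r : ℂ) * (Circle.exp θ : ℂ)) = θ := by
  unfold ccwAngle
  rw [div_one, Complex.arg_real_mul _ hr, Circle.coe_exp, Complex.arg_exp_mul_I,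
    toIcoMod_eq_iff, zero_add]
  refine ⟨hθ, -toIocDiv Real.two_pi_pos (-Real.pi) θ, ?_⟩
  rw [toIocMod, neg_smul]; ring

lemma ccwAngle_one_zero : ccwAngle 1 0 = 0 := by
  unfold ccwAngle
  rw [zero_div, Complex.arg_zero, toIcoMod_eq_iff]
  exact ⟨⟨le_rfl, by linarith [Real.two_pi_pos]⟩, 0, by simp⟩

lemma eq_one_of_ccwAngle_eq_zero {d : ℂ} (hd : ‖d‖ = 1) (h : ccwAngle 1 d = 0) : d = 1 := by
  rw [← norm_mul_exp_ccwAngle d, h, hd]; simp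

lemma rotor_one (s : ℕ) : rotor s 1 = 1 := by
  unfold rotor; simp

lemma rotor_succ (s i : ℕ) : rotor s (i + 1) = Circle.exp (2 * Real.pi / s) ^ i := by
  unfold rotor
  rw [← Circle.exp_natCast_mul]
  congr 1
  push_cast; ring

lemma rotor_ne_zero (s i : ℕ) : (rotor s i : ℂ) ≠ 0 := Circle.coe_ne_zero _

lemma circle_exp_pow {s : ℕ} (hs : 1 ≤ s) : Circle.exp (2 * Real.pi / s) ^ s = 1 := by
  have : (s : ℝ) ≠ 0 := by positivity
  rw [← Circle.exp_natCast_mul, mul_div_cancel₀ _ this, Circle.exp_two_pi]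

lemma sector_angle_pos {s : ℕ} (hs : 1 ≤ s) : 0 < 2 * Real.pi / s := by
  have : (0 : ℝ) < s := by positivity
  have := Real.two_pi_pos
  positivity

lemma mul_sector_angle {s : ℕ} (hs : 1 ≤ s) : (s : ℝ) * (2 * Real.pi / s) = 2 * Real.pi := by
  have : (s : ℝ) ≠ 0 := by positivity
  field_simp

/-- The origin has angle 0 and lies in the first cone only, so it must be excluded unless there is
just one cone. -/
lemma rotor_mul_mem_cone {s i : ℕ} (hi : i ∈ Finset.Icc 1 s) {z : ℂ} (hz : z ∈ cone s 1)
    (h0 : s = 1 ∨ z ≠ 0) : (rotor s i : ℂ) * z ∈ cone s i := by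
  rw [Finset.mem_Icc] at hi
  rcases h0 with h0 | h0
  · obtain rfl : i = 1 := by omega
    rwa [rotor_one, Circle.coe_one, one_mul]
  have hs : 1 ≤ s := hi.1.trans hi.2
  have hα := sector_angle_pos hs
  simp only [cone, Set.mem_ofPred_eq, Set.mem_Ico] at hz ⊢
  have h1 : (1 : ℝ) ≤ i := by exact_mod_cast hi.1
  have h2 : (i : ℝ) ≤ s := by exact_mod_cast hi.2
  have h3 : (i : ℝ) * (2 * Real.pi / s) ≤ 2 * Real.pi := by
    exact (mul_le_mul_of_nonneg_right h2 hα.le).trans_eq (mul_sector_angle hs)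
  have h4 : ((i : ℝ) - 1) * (2 * Real.pi / s) ≥ 0 := mul_nonneg (by linarith) hα.le
  have key : (rotor s i : ℂ) * z = (‖z‖ : ℂ) *
      (Circle.exp (((i : ℝ) - 1) * (2 * Real.pi / s) + ccwAngle 1 z) : ℂ) := by
    rw [Circle.exp_add, Circle.coe_mul]
    conv_lhs => rw [← norm_mul_exp_ccwAngle z]
    unfold rotor; ring
  rw [key]
  norm_num at hz
  rw [ccwAngle_one_eq (norm_pos_iff.2 h0)]
  · constructor <;> linarith
  · constructor <;> linarith

lemma exists_rotor_mul_of_mem_cone {s i : ℕ} (hi : i ∈ Finset.Icc 1 s) {z : ℂ}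
    (hz : z ∈ cone s i) : ∃ z' ∈ cone s 1, (rotor s i : ℂ) * z' = z := by
  rw [Finset.mem_Icc] at hi
  have hs : 1 ≤ s := hi.1.trans hi.2
  have hα := sector_angle_pos hs
  rcases eq_or_ne z 0 with rfl | h0
  · refine ⟨0, ?_, mul_zero _⟩
    simp only [cone, Set.mem_ofPred_eq, ccwAngle_one_zero]
    norm_num
    positivity
  · simp only [cone, Set.mem_ofPred_eq, Set.mem_Ico] at hz
    refine ⟨(‖z‖ : ℂ) * (Circle.exp (ccwAngle 1 z - ((i : ℝ) - 1) * (2 * Real.pi / s)) : ℂ),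
      ?_, ?_⟩
    · have h3 : 1 * (2 * Real.pi / s) ≤ 2 * Real.pi := by
        have h4 : (1 : ℝ) ≤ s := by exact_mod_cast hs
        exact (mul_le_mul_of_nonneg_right h4 hα.le).trans_eq (mul_sector_angle hs)
      simp only [cone, Set.mem_ofPred_eq, Set.mem_Ico]
      rw [ccwAngle_one_eq (norm_pos_iff.2 h0)]
      · constructor <;> norm_num <;> linarith
      · constructor <;> linarith
    · conv_rhs => rw [← norm_mul_exp_ccwAngle z]
      unfold rotor
      rw [mul_left_comm, ← Circle.coe_mul, ← Circle.exp_add]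
      congr 3; ring

lemma cone_index_unique {s i i' : ℕ} (hi : i ∈ Finset.Icc 1 s) {z : ℂ}
    (hz : z ∈ cone s i) (hz' : z ∈ cone s i') : i = i' := by
  rw [Finset.mem_Icc] at hi
  have hα := sector_angle_pos (hi.1.trans hi.2)
  simp only [cone, Set.mem_ofPred_eq, Set.mem_Ico] at hz hz'
  have h1 := lt_of_mul_lt_mul_right (hz.1.trans_lt hz'.2) hα.le
  have h2 := lt_of_mul_lt_mul_right (hz'.1.trans_lt hz.2) hα.le
  have h1' : i < i' + 1 := by exact_mod_cast (by linarith : (i : ℝ) < i' + 1)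
  have h2' : i' < i + 1 := by exact_mod_cast (by linarith : (i' : ℝ) < i + 1)
  omega

lemma exists_mem_cone {s : ℕ} (hs : 1 ≤ s) (z : ℂ) : ∃ i ∈ Finset.Icc 1 s, z ∈ cone s i := by
  have hα := sector_angle_pos hs
  obtain ⟨h0, h1⟩ := ccwAngle_mem 1 z
  have hq : 0 ≤ ccwAngle 1 z / (2 * Real.pi / s) := div_nonneg h0 hα.le
  have hq1 : ccwAngle 1 z / (2 * Real.pi / s) < s := by
    rw [div_lt_iff₀ hα, mul_sector_angle hs]; exact h1
  refine ⟨⌊ccwAngle 1 z / (2 * Real.pi / s)⌋₊ + 1, ?_, ?_⟩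
  · rw [Finset.mem_Icc]
    exact ⟨by omega, (Nat.floor_lt hq).2 hq1⟩
  · simp only [cone, Set.mem_ofPred_eq, Set.mem_Ico]
    push_cast
    rw [← le_div_iff₀ hα, ← div_lt_iff₀ hα]
    exact ⟨by linarith [Nat.floor_le hq], Nat.lt_floor_add_one _⟩

lemma cone_one_one : cone 1 1 = Set.univ := by
  refine Set.eq_univ_of_forall fun z => ?_
  obtain ⟨i, hi, hz⟩ := exists_mem_cone le_rfl z
  rw [Finset.mem_Icc] at hi
  obtain rfl : i = 1 := by omega
  exact hz

/-! ### Depth inside a cone -/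

/-- The open core of the first cone. -/
def openCone (s : ℕ) : Set ℂ :=
  {z | s = 1 ∨ (0 < z.im ∧ (z * Complex.exp (-(2 * Real.pi / s : ℝ) * Complex.I)).im < 0)}

lemma polar_im (r θ α : ℝ) :
    ((r : ℂ) * (Circle.exp θ : ℂ)).im = r * Real.sin θ ∧
    ((r : ℂ) * (Circle.exp θ : ℂ) * Complex.exp (-(α : ℝ) * Complex.I)).im
      = r * Real.sin (θ - α) := by
  constructor
  · rw [Circle.coe_exp, Complex.re_ofReal_mul |> fun _ => Complex.im_ofReal_mul,
      Complex.exp_ofReal_mul_I_im]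
  · rw [Circle.coe_exp, mul_assoc, ← Complex.exp_add, Complex.im_ofReal_mul,
      ← Complex.exp_ofReal_mul_I_im]
    congr 3
    push_cast; ring

lemma sector_angle_le_pi {s : ℕ} (hs : 2 ≤ s) : 2 * Real.pi / s ≤ Real.pi := by
  have : (2 : ℝ) ≤ s := by exact_mod_cast hs
  rw [div_le_iff₀ (by linarith)]
  nlinarith [Real.pi_pos]

/-- Points whose angle is at most that of the first cone lie in the closed half planes that
cut out the cone. -/
lemma im_of_ccwAngle_lt {s : ℕ} (hs : 2 ≤ s) {z : ℂ} (hz : ccwAngle 1 z < 2 * Real.pi / s) :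
    0 ≤ z.im ∧ (z * Complex.exp (-(2 * Real.pi / s : ℝ) * Complex.I)).im ≤ 0 := by
  have h1 := sector_angle_le_pi hs
  have h0 := (ccwAngle_mem 1 z).1
  have hp := polar_im ‖z‖ (ccwAngle 1 z) (2 * Real.pi / s)
  rw [norm_mul_exp_ccwAngle] at hp
  rw [hp.1, hp.2]
  constructor
  · exact mul_nonneg (norm_nonneg _) (Real.sin_nonneg_of_nonneg_of_le_pi h0 (by linarith))
  · exact mul_nonpos_of_nonneg_of_nonpos (norm_nonneg _)
      (Real.sin_nonpos_of_nonpos_of_neg_pi_le (by linarith) (by linarith))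

/-- The sign of the first sine puts the angle below π; given that, the sign of the second puts it
below 2π/s. -/
lemma openCone_subset_cone {s : ℕ} (hs : 1 ≤ s) : openCone s ⊆ cone s 1 := by
  rcases Nat.lt_or_ge 1 s with h2 | h2
  swap
  · obtain rfl : s = 1 := by omega
    rw [cone_one_one]; exact Set.subset_univ _
  rintro z (rfl | ⟨ha, hb⟩)
  · omega
  have hp := polar_im ‖z‖ (ccwAngle 1 z) (2 * Real.pi / s)
  rw [norm_mul_exp_ccwAngle] at hp
  rw [hp.1] at ha
  rw [hp.2] at hb
  have h1 := sector_angle_le_pi h2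
  have h3 := sector_angle_pos hs
  obtain ⟨h0, h0'⟩ := ccwAngle_mem 1 z
  have hn := norm_nonneg z
  simp only [cone, Set.mem_ofPred_eq, Set.mem_Ico]
  norm_num
  refine ⟨h0, ?_⟩
  by_contra hcon
  push Not at hcon
  have hπ : ccwAngle 1 z < Real.pi := by
    by_contra hc
    push Not at hc
    have : Real.sin (ccwAngle 1 z) ≤ 0 := by
      rw [← neg_neg (Real.sin _), ← Real.sin_sub_pi]
      have := Real.sin_nonneg_of_nonneg_of_le_pi (x := ccwAngle 1 z - Real.pi) (by linarith)
        (by linarith)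
      linarith
    nlinarith
  have := Real.sin_nonneg_of_nonneg_of_le_pi (x := ccwAngle 1 z - 2 * Real.pi / s) (by linarith)
    (by linarith)
  nlinarith

lemma ne_zero_of_mem_openCone {s : ℕ} {z : ℂ} (hz : z ∈ openCone s) : s = 1 ∨ z ≠ 0 := by
  rcases hz with h | h
  · exact Or.inl h
  · right; rintro rfl; simp at h

/-- The cone satisfies the weak half-plane inequalities. A small step along the outward normal of
either boundary line stays in the cone, which makes both inequalities strict. -/
lemma interior_cone_subset {s : ℕ} (hs : 1 ≤ s) : interior (cone s 1) ⊆ openCone s := by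
  rcases Nat.lt_or_ge 1 s with h2 | h2
  swap
  · exact fun z _ => Or.inl (by omega)
  intro z hz
  rw [mem_interior_iff_mem_nhds, Metric.mem_nhds_iff] at hz
  obtain ⟨τ, hτ, hball⟩ := hz
  have hmem : ∀ w : ℂ, ‖w‖ = 1 → 0 ≤ (z + (τ / 2 : ℝ) * w).im ∧
      ((z + (τ / 2 : ℝ) * w) * Complex.exp (-(2 * Real.pi / s : ℝ) * Complex.I)).im ≤ 0 := by
    intro w hw
    refine im_of_ccwAngle_lt h2 ?_
    have : z + (τ / 2 : ℝ) * w ∈ cone s 1 := by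
      apply hball
      rw [Metric.mem_ball, dist_eq_norm, add_sub_cancel_left, norm_mul, hw, mul_one,
        Complex.norm_real, Real.norm_of_nonneg (by positivity)]
      linarith
    have := this.2
    simpa using this
  right
  constructor
  · have := (hmem (-Complex.I) (by simp)).1
    rw [Complex.add_im, Complex.im_ofReal_mul] at this
    simp at this
    linarith
  · have := (hmem (Complex.I * Complex.exp ((2 * Real.pi / s : ℝ) * Complex.I)) (by
      rw [norm_mul, Complex.norm_exp_ofReal_mul_I, Complex.norm_I, mul_one])).2
    rw [add_mul, Complex.add_im, mul_assoc, mul_assoc, ← Complex.exp_add,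
      Complex.im_ofReal_mul, neg_mul, add_neg_cancel, Complex.exp_zero,
      mul_one, Complex.I_im] at this
    rw [neg_mul]
    linarith

/-- The ball is connected, misses the frontier and meets the interior, so it cannot reach the
exterior. -/
lemma closedBall_subset_openCone {s : ℕ} (hs : 1 ≤ s) {z : ℂ} {ε : ℝ} (hε : 0 ≤ ε)
    (hz : z ∈ cone s 1) (hf : ∀ y ∈ frontier (cone s 1), ε < dist z y) :
    Metric.closedBall z ε ⊆ openCone s := by
  refine subset_trans ?_ (interior_cone_subset hs)
  have hnf : ∀ y ∈ Metric.closedBall z ε, y ∉ frontier (cone s 1) := fun y hy hy' => by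
    rw [Metric.mem_closedBall'] at hy
    exact absurd (hf y hy') (not_lt.2 hy)
  have hzb := Metric.mem_closedBall_self (x := z) hε
  refine IsPreconnected.subset_left_of_subset_union isOpen_interior
    (isClosed_closure (s := cone s 1)).isOpen_compl
    (Set.disjoint_left.2 fun y hy hy' => hy' (interior_subset_closure hy)) ?_ ?_
    (convex_closedBall z ε).isPreconnected
  · intro y hy
    by_cases h : y ∈ closure (cone s 1)
    · left
      by_contra h'
      exact hnf y hy ⟨h, h'⟩
    · exact Or.inr h
  · refine ⟨z, hzb, ?_⟩
    by_contra h'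
    exact hnf z hzb ⟨subset_closure hz, h'⟩

/-- An open half plane through the origin absorbs vectors of its closure. This transfers depth in
the cone from an anchor to its whole hull, whose span is at most 2π/s. -/
lemma openCone_add {s : ℕ} {z x : ℂ} (hz : z ∈ openCone s)
    (hx : ccwAngle 1 x < 2 * Real.pi / s) (hs : 1 ≤ s) : z + x ∈ openCone s := by
  rcases Nat.lt_or_ge 1 s with h2 | h2
  swap
  · exact Or.inl (by omega)
  rcases hz with rfl | ⟨ha, hb⟩
  · omega
  obtain ⟨hc, hd⟩ := im_of_ccwAngle_lt h2 hx
  right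
  rw [add_mul, Complex.add_im, Complex.add_im]
  constructor <;> linarith

lemma closedBall_add_subset_openCone {s : ℕ} (hs : 1 ≤ s) {z x : ℂ} {ε : ℝ}
    (hz : Metric.closedBall z ε ⊆ openCone s) (hx : ccwAngle 1 x < 2 * Real.pi / s) :
    Metric.closedBall (z + x) ε ⊆ openCone s := by
  intro y hy
  have : y - x ∈ openCone s := by
    apply hz
    rw [Metric.mem_closedBall, dist_eq_norm] at hy ⊢
    rwa [sub_sub, add_comm x]
  simpa using openCone_add this hx hs

lemma rotor_mul_mem_cone_of_openCone {s i : ℕ} (hi : i ∈ Finset.Icc 1 s) {z : ℂ}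
    (hz : z ∈ openCone s) : (rotor s i : ℂ) * z ∈ cone s i := by
  have hs : 1 ≤ s := (Finset.mem_Icc.1 hi).1.trans (Finset.mem_Icc.1 hi).2
  exact rotor_mul_mem_cone hi (openCone_subset_cone hs hz) (ne_zero_of_mem_openCone hz)

lemma dist_circle_mul (w : Circle) (x y : ℂ) : dist ((w : ℂ) * x) (w * y) = dist x y := by
  rw [dist_eq_norm, dist_eq_norm, ← mul_sub, norm_mul, Circle.norm_coe, one_mul]

/-- A point deep inside the `i`-th cone is far from all points of the other cones. -/
lemma lt_dist_of_mem_cone {s i i' : ℕ} (hi : i ∈ Finset.Icc 1 s) (hne : i ≠ i') {z y : ℂ} {ε : ℝ}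
    (hz : Metric.closedBall z ε ⊆ openCone s) (hy : y ∈ cone s i') :
    ε < dist ((rotor s i : ℂ) * z) y := by
  by_contra hcon
  push Not at hcon
  have h0 := rotor_ne_zero s i
  have h1 : (rotor s i : ℂ) * ((rotor s i : ℂ)⁻¹ * y) = y := by field_simp
  have : (rotor s i : ℂ)⁻¹ * y ∈ openCone s := by
    apply hz
    rw [Metric.mem_closedBall', ← dist_circle_mul (rotor s i), h1]
    exact hcon
  have := rotor_mul_mem_cone_of_openCone hi this
  rw [h1] at this
  exact hne (cone_index_unique hi this hy)

/-! ### The symmetric components of a pattern -/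

/-- For two distinct centres the parallelogram law yields a smaller disc about the midpoint. Radius
0 is separate: both centres then equal the only point of `P`. -/
lemma IsEnclosingCenter.unique {P : Set ℂ} (hP : P.Nonempty) {c c' : ℂ}
    (h : IsEnclosingCenter P c) (h' : IsEnclosingCenter P c') : c = c' := by
  obtain ⟨r, hr, hmin⟩ := h
  obtain ⟨r', hr', hmin'⟩ := h'
  obtain rfl : r = r' := le_antisymm (hmin _ _ hr') (hmin' _ _ hr)
  obtain ⟨p, hp⟩ := hP
  have hr0 : 0 ≤ r := dist_nonneg.trans (hr hp)
  by_contra hne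
  have hpos : 0 < ‖c - c'‖ := norm_pos_iff.2 (sub_ne_zero.2 hne)
  have hsub : P ⊆ Metric.closedBall ((1 / 2 : ℝ) • (c + c')) (√(r ^ 2 - ‖c - c'‖ ^ 2 / 4)) := by
    intro q hq
    have h1 := hr hq
    have h2 := hr' hq
    rw [Metric.mem_closedBall, dist_eq_norm] at h1 h2 ⊢
    have hpar := parallelogram_law_with_norm ℝ (q - c) (q - c')
    have e1 : q - c + (q - c') = (2 : ℝ) • (q - (1 / 2 : ℝ) • (c + c')) := by
      rw [smul_sub, smul_smul]; norm_num; rw [two_mul]; ring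
    have e2 : q - c - (q - c') = -(c - c') := by ring
    rw [e1, e2, norm_neg, norm_smul, Real.norm_of_nonneg (by norm_num : (0 : ℝ) ≤ 2)] at hpar
    apply Real.le_sqrt_of_sq_le
    have h3 := mul_self_le_mul_self (norm_nonneg _) h1
    have h4 := mul_self_le_mul_self (norm_nonneg _) h2
    nlinarith
  have h5 := hmin _ _ hsub
  have h6 : √(r ^ 2 - ‖c - c'‖ ^ 2 / 4) < r ∨ r = 0 := by
    rcases hr0.lt_or_eq with h | h
    · left
      rw [Real.sqrt_lt' h]
      nlinarith
    · exact Or.inr h.symm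
  rcases h6 with h6 | h6
  · linarith
  · have h1 := hr hp
    have h2 := hr' hp
    rw [h6, Metric.mem_closedBall, dist_le_zero] at h1 h2
    exact hne (h1.symm.trans h2)

lemma rotor_mul_mem {P : Set ℂ} {s : ℕ} (hP : HasRegularPartition P 0 s) (i : ℕ)
    {p : ℂ} (hp : p ∈ P) : ((Circle.exp (2 * Real.pi / s) ^ i : Circle) : ℂ) * p ∈ P := by
  induction i with
  | zero => simpa
  | succ i ih =>
    have := (hP.2 _ ih).2
    rw [pow_succ', Circle.coe_mul, mul_assoc]
    simpa using this

lemma component_eq_image {P : Set ℂ} {s i : ℕ} (hP : HasRegularPartition P 0 s)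
    (hi : i ∈ Finset.Icc 1 s) :
    component P s i = (fun z => (rotor s i : ℂ) * z) '' component P s 1 := by
  obtain ⟨h1, h2⟩ := Finset.mem_Icc.1 hi
  obtain ⟨j, rfl⟩ : ∃ j, i = j + 1 := ⟨i - 1, by omega⟩
  ext z
  constructor
  · rintro ⟨hz, hc⟩
    obtain ⟨z', hz', rfl⟩ := exists_rotor_mul_of_mem_cone hi hc
    refine ⟨z', ⟨?_, hz'⟩, rfl⟩
    -- The partition only provides forward rotations; turning back `j` steps is turning forward `s -
    -- j` steps.
    have := rotor_mul_mem hP (s - j) hz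
    rwa [rotor_succ, ← mul_assoc, ← Circle.coe_mul, ← pow_add, Nat.sub_add_cancel (by omega),
      circle_exp_pow hP.1, Circle.coe_one, one_mul] at this
  · rintro ⟨z', ⟨hz, hc⟩, rfl⟩
    refine ⟨?_, ?_⟩
    · simp only [rotor_succ]
      exact rotor_mul_mem hP j hz
    · refine rotor_mul_mem_cone hi hc ?_
      rcases Nat.lt_or_ge 1 s with h | h
      · exact Or.inr ((hP.2 _ hz).1 h)
      · left; omega


/-! ### Protocols that realise prescribed trajectories -/

/-- Snapshots are sets of points, so labels are invisible. This lets a single labelled choreography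
govern every initial configuration. -/
lemma snapshot_comp {ι Λ : Type} (Y : Λ → ℂ) {φ : ι → Λ} (hφ : Function.Surjective φ) (r : ι)
    (u : Circle) : snapshot (Y ∘ φ) r u = snapshot Y (φ r) u := by
  ext z
  simp only [snapshot, Function.comp_apply, Set.mem_ofPred_eq]
  exact (hφ.exists (p := fun l => dist (Y l) (Y (φ r)) ≤ 1 ∧ (u : ℂ) * z = Y l - Y (φ r))).symm

/-- Trajectories are realised by a protocol if steps have length at most `1` and robots with the
same snapshot take the same step in their local coordinates. -/
lemma exists_protocol {Λ : Type} (X : ℕ → Λ → ℂ) (good : ℕ → Prop)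
    (hstep : ∀ t, good t → ∀ b, ‖X (t + 1) b - X t b‖ ≤ 1)
    (hcons : ∀ t t', good t → good t' → ∀ b b' (u u' : Circle),
      snapshot (X t) b u = snapshot (X t') b' u' →
      ((u⁻¹ : Circle) : ℂ) * (X (t + 1) b - X t b) =
        ((u'⁻¹ : Circle) : ℂ) * (X (t' + 1) b' - X t' b')) :
    ∃ A : Protocol, ∀ (ι : Type) (R : ι → ℂ) (φ : ι → Λ), Function.Surjective φ →
      R = X 0 ∘ φ → ∀ (u : ℕ → ι → Circle) (t : ℕ), (∀ t' < t, good t') →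
      A.run u R t = X t ∘ φ := by
  classical
  -- The look-up table: a snapshot may arise in several ways, and `hcons` says that the choice does
  -- not matter. Snapshots that never arise get the move 0.
  let f : Set ℂ → ℂ := fun S =>
    if h : ∃ q : ℕ × Λ × Circle, good q.1 ∧ S = snapshot (X q.1) q.2.1 q.2.2 then
      ((h.choose.2.2⁻¹ : Circle) : ℂ) *
        (X (h.choose.1 + 1) h.choose.2.1 - X h.choose.1 h.choose.2.1)
    else 0
  have hf : ∀ S, ‖f S‖ ≤ 1 := fun S => by
    simp only [f]
    split_ifs with h
    · rw [norm_mul, Circle.norm_coe, one_mul]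
      exact hstep _ h.choose_spec.1 _
    · simp
  have hf' : ∀ t, good t → ∀ b u, f (snapshot (X t) b u) =
      ((u⁻¹ : Circle) : ℂ) * (X (t + 1) b - X t b) := fun t ht b u => by
    have h : ∃ q : ℕ × Λ × Circle, good q.1 ∧
        snapshot (X t) b u = snapshot (X q.1) q.2.1 q.2.2 := ⟨(t, b, u), ht, rfl⟩
    simp only [f]
    rw [dif_pos h]
    exact (hcons _ _ ht h.choose_spec.1 _ _ _ _ h.choose_spec.2).symm
  refine ⟨⟨f, hf⟩, fun ι R φ hφ hR u t => ?_⟩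
  induction t with
  | zero => intro _; exact hR
  | succ t ih =>
    intro hgood
    have ih := ih fun t' ht' => hgood t' (by omega)
    funext r
    simp only [Protocol.run, Protocol.step]
    rw [ih, snapshot_comp _ hφ, hf' t (hgood t (by omega)), ← mul_assoc, ← Circle.coe_mul,
      mul_inv_cancel, Circle.coe_one, one_mul]
    simp

/-- Every robot seen by `b` in configuration `Y` corresponds, after a rotation by `w`, to a robot
seen by `b'` in configuration `Y'`. -/
def Matches {Λ : Type} (Y : Λ → ℂ) (b : Λ) (Y' : Λ → ℂ) (b' : Λ) (w : Circle) : Prop :=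
  ∀ a, dist (Y a) (Y b) ≤ 1 → ∃ a', dist (Y' a') (Y' b') ≤ 1 ∧
    Y' a' - Y' b' = (w : ℂ) * (Y a - Y b)

lemma matches_of_snapshot_eq {Λ : Type} {Y Y' : Λ → ℂ} {b b' : Λ} {u u' : Circle}
    (h : snapshot Y b u = snapshot Y' b' u') : Matches Y b Y' b' (u' * u⁻¹) := by
  intro a ha
  have hz : ((u⁻¹ : Circle) : ℂ) * (Y a - Y b) ∈ snapshot Y b u := by
    refine ⟨a, ha, ?_⟩
    rw [← mul_assoc, ← Circle.coe_mul, mul_inv_cancel, Circle.coe_one, one_mul]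
  rw [h] at hz
  obtain ⟨a', ha', heq⟩ := hz
  refine ⟨a', ha', ?_⟩
  rw [← heq, ← mul_assoc, Circle.coe_mul]

lemma ncard_snapshot_le {Λ : Type} [Fintype Λ] (Y : Λ → ℂ) (b : Λ) (u : Circle) :
    (snapshot Y b u).ncard ≤ {a | dist (Y a) (Y b) ≤ 1}.ncard := by
  have : snapshot Y b u =
      (fun a => ((u⁻¹ : Circle) : ℂ) * (Y a - Y b)) '' {a | dist (Y a) (Y b) ≤ 1} := by
    ext z
    simp only [snapshot, Set.mem_ofPred_eq, Set.mem_image]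
    refine exists_congr fun a => and_congr_right fun _ => ?_
    rw [Circle.coe_inv, inv_mul_eq_iff_eq_mul₀ (Circle.coe_ne_zero u), eq_comm]
  rw [this]
  exact Set.ncard_image_le (Set.toFinite _)

lemma card_le_ncard_snapshot {Λ : Type} [Fintype Λ] {Y : Λ → ℂ} (hY : Function.Injective Y) {b : Λ}
    (hb : ∀ a, dist (Y a) (Y b) ≤ 1) (u : Circle) :
    Fintype.card Λ ≤ (snapshot Y b u).ncard := by
  have : snapshot Y b u =
      (fun a => ((u⁻¹ : Circle) : ℂ) * (Y a - Y b)) '' Set.univ := by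
    ext z
    simp only [snapshot, Set.mem_ofPred_eq, Set.mem_image, Set.mem_univ, true_and]
    refine exists_congr fun a => ?_
    rw [Circle.coe_inv, inv_mul_eq_iff_eq_mul₀ (Circle.coe_ne_zero u), eq_comm]
    exact ⟨fun h => h.2, fun h => ⟨hb a, h⟩⟩
  rw [this, Set.ncard_image_of_injective, Set.ncard_univ, Nat.card_eq_fintype_card]
  intro a a' h
  have := mul_left_cancel₀ (Circle.coe_ne_zero (u⁻¹)) h
  exact hY (sub_left_injective this)

/-! ### Clusters with a head -/

/-- The points of `S` other than its head are closer to one another than to the head. -/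
def IsHead (S : Set ℂ) (h : ℂ) : Prop :=
  h ∈ S ∧ ∀ x ∈ S, x ≠ h → ∀ x' ∈ S, x' ≠ h → dist x x' < dist x h

/-- A third point would be strictly closer to each of two heads than to the other. -/
lemma IsHead.unique {S : Set ℂ} {h h' : ℂ} (hS : ∀ y y', ∃ x ∈ S, x ≠ y ∧ x ≠ y')
    (H : IsHead S h) (H' : IsHead S h') : h = h' := by
  by_contra hne
  obtain ⟨x, hx, h1, h2⟩ := hS h h'
  have h3 := H.2 x hx h1 h' H'.1 (Ne.symm hne)
  have h4 := H'.2 x hx h2 h H.1 hne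
  linarith

lemma IsHead.image {S : Set ℂ} {h : ℂ} (H : IsHead S h) {g : ℂ → ℂ} (hg : Isometry g) :
    IsHead (g '' S) (g h) := by
  refine ⟨⟨h, H.1, rfl⟩, ?_⟩
  rintro _ ⟨x, hx, rfl⟩ hxh _ ⟨x', hx', rfl⟩ hxh'
  rw [hg.dist_eq, hg.dist_eq]
  exact H.2 x hx (fun e => hxh (by rw [e])) x' hx' (fun e => hxh' (by rw [e]))

lemma isometry_rigid (w : Circle) (y y' : ℂ) : Isometry fun z : ℂ => (w : ℂ) * (z - y) + y' := by
  refine Isometry.of_dist_eq fun a b => ?_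
  rw [dist_add_right, dist_circle_mul, dist_sub_right]

/-- A cluster with a head has no rotational symmetry about its head. -/
lemma IsHead.eq_one {S : Set ℂ} (hfin : S.Finite) {h : ℂ} (H : IsHead S h) {x : ℂ} (hx : x ∈ S)
    (hxh : x ≠ h) {w : Circle} (hw : ∀ z ∈ S, (w : ℂ) * (z - h) + h ∈ S) : w = 1 := by
  classical
  lift S to Finset ℂ using hfin
  have hinj : Function.Injective fun z : ℂ => (w : ℂ) * (z - h) + h := (isometry_rigid w h h).injective
  have himg : S.image (fun z : ℂ => (w : ℂ) * (z - h) + h) = S := by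
    refine Finset.eq_of_subset_of_card_le ?_ ?_
    · intro z hz
      obtain ⟨y, hy, rfl⟩ := Finset.mem_image.1 hz
      exact hw y hy
    · rw [Finset.card_image_of_injective _ hinj]
  -- A rotation that permutes `S` and fixes the head fixes this sum. The sum is nonzero, because
  -- every nonzero summand makes an acute angle with `x - h`: in the triangle of `h`, `x` and `z`
  -- the side opposite `h` is shorter than the one from `h` to `x`.
  set σ : ℂ := ∑ z ∈ S, (z - h)
  have hσ : (w : ℂ) * σ = σ := by
    conv_rhs => rw [show σ = ∑ z ∈ S, (z - h) from rfl, ← himg]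
    rw [Finset.sum_image hinj.injOn, Finset.mul_sum]
    simp
  have hpos : ∀ z ∈ S, z ≠ h → 0 < inner ℝ (x - h) (z - h) := by
    intro z hz hzh
    rw [real_inner_eq_norm_mul_self_add_norm_mul_self_sub_norm_sub_mul_self_div_two,
      sub_sub_sub_cancel_right, ← dist_eq_norm, ← dist_eq_norm, ← dist_eq_norm]
    have h1 := H.2 x hx hxh z hz hzh
    have h2 : 0 < dist z h := dist_pos.2 hzh
    have h3 : 0 ≤ dist x z := dist_nonneg
    nlinarith
  have hne : σ ≠ 0 := by
    intro h0
    have h1 : inner ℝ (x - h) σ = 0 := by rw [h0, inner_zero_right]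
    rw [inner_sum] at h1
    have h2 : ∀ z ∈ S, 0 ≤ inner ℝ (x - h) (z - h) := fun z hz => by
      by_cases hzh : z = h
      · rw [hzh, sub_self, inner_zero_right]
      · exact (hpos z hz hzh).le
    have := (Finset.sum_eq_zero_iff_of_nonneg h2).1 h1 x hx
    exact (hpos x hx hxh).ne' this
  have : (w : ℂ) = 1 := mul_right_cancel₀ hne (by rw [hσ, one_mul])
  exact Circle.ext this

/-! ### Symmetric choreographies -/

/-- The position at time `t` of the `b.2`-th robot of the `(b.1 + 1)`-st formation if the robots of
the first formation follow the trajectories `x`. -/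
noncomputable def place {N : ℕ} (s : ℕ) (x : ℕ → Fin N → ℂ) (t : ℕ) (b : Fin s × Fin N) : ℂ :=
  (rotor s (b.1 + 1) : ℂ) * x t b.2

/-- Trajectories `x` of the robots of one formation, from a granular state at time `0` via
tight clusters with a head at the times `1, …, k` to a final configuration at time `k + 1`. -/
structure Choreography (ε : ℝ) (s N k : ℕ) (x : ℕ → Fin N → ℂ) where
  anchor : ℂ
  first : Fin N
  second : Fin N
  third : Fin N
  far : ℝ
  act : ℕ → Set (Fin N)
  head : Fin N
  center : ℕ → ℂ
  size : ℕ → ℝ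
  maxSize : ℝ
  inj : ∀ t ≤ k, Function.Injective (place s x t)
  eps_pos : 0 < ε
  visible : ∀ b b', dist (place s x 0 b) (place s x 0 b') ≤ 1
  sep : ∀ b b', b ≠ b' → ε ≤ dist (place s x 0 b) (place s x 0 b')
  eps_pair : ∀ b b', dist (place s x 0 b) (place s x 0 b') = ε →
    b.1 = b'.1 ∧ ((b.2 = first ∧ b'.2 = second) ∨ (b.2 = second ∧ b'.2 = first))
  first_eq : x 0 first = anchor
  second_eq : x 0 second = anchor + (ε : ℂ)
  third_eq : x 0 third = anchor + (far : ℂ)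
  lt_far : ε < far
  anchor_re_le : ∀ m, anchor.re ≤ (x 0 m).re
  anchor_im_pos : 2 ≤ s → 0 < anchor.im
  rest : ∀ t, 1 ≤ t → t ≤ k → ∀ m ∉ act t, x (t + 1) m = x t m
  rest_end : ∀ t, k < t → x (t + 1) = x t
  head_mem : ∀ t, 1 ≤ t → t ≤ k → head ∈ act t
  dist_head : ∀ t, 1 ≤ t → t ≤ k → dist (x t head) (center t) = size t
  dist_le : ∀ t, 1 ≤ t → t ≤ k → ∀ m ∈ act t, m ≠ head → dist (x t m) (center t) ≤ size t / 10
  exists_act : ∀ t, 1 ≤ t → t ≤ k → ∀ m m', ∃ l ∈ act t, l ≠ m ∧ l ≠ m'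
  size_pos : ∀ t, 0 < size t
  size_le : ∀ t, size t ≤ maxSize
  size_lt : ∀ t t', t < t' → 2 * size t' ≤ size t
  separated : ∀ t, 1 ≤ t → t ≤ k → ∀ b b', b ≠ b' →
    ¬ (b.1 = b'.1 ∧ b.2 ∈ act t ∧ b'.2 ∈ act t) →
    4 * maxSize ≤ dist (place s x t b) (place s x t b')
  maxSize_le : 4 * maxSize ≤ ε
  maxSize_le_one : 4 * maxSize ≤ 1

namespace Choreography

variable {ε : ℝ} {s N k : ℕ} {x : ℕ → Fin N → ℂ}

/-- The cluster that formation `i` forms at time `t`. -/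
def cluster (c : Choreography ε s N k x) (t : ℕ) (i : Fin s) : Set ℂ :=
  place s x t '' {b | b.1 = i ∧ b.2 ∈ c.act t}

lemma dist_place (t : ℕ) (i : Fin s) (m m' : Fin N) :
    dist (place s x t (i, m)) (place s x t (i, m')) = dist (x t m) (x t m') :=
  dist_circle_mul _ _ _

lemma dist_act_le (c : Choreography ε s N k x) {t : ℕ} (h1 : 1 ≤ t) (hk : t ≤ k) {m : Fin N} (hm : m ∈ c.act t) :
    dist (x t m) (c.center t) ≤ c.size t := by
  by_cases h : m = c.head
  · rw [h, c.dist_head t h1 hk]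
  · have := c.dist_le t h1 hk m hm h
    have := c.size_pos t
    linarith

lemma dist_act_act (c : Choreography ε s N k x) {t : ℕ} (h1 : 1 ≤ t) (hk : t ≤ k)
    {b b' : Fin s × Fin N} (hb : b.2 ∈ c.act t) (hb' : b'.2 ∈ c.act t) (h : b.1 = b'.1) :
    dist (place s x t b) (place s x t b') < 4 * c.maxSize := by
  obtain ⟨i, m⟩ := b
  obtain ⟨i', m'⟩ := b'
  simp only at h hb hb'
  subst h
  rw [dist_place]
  have := dist_triangle_right (x t m) (x t m') (c.center t)
  have := c.dist_act_le h1 hk hb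
  have := c.dist_act_le h1 hk hb'
  have := c.size_pos t
  have := c.size_le t
  linarith

/-- Two followers are within a fifth of the size of each other, whereas a follower and the head are
at least nine tenths of it apart. -/
lemma isHead_act (c : Choreography ε s N k x) {t : ℕ} (h1 : 1 ≤ t) (hk : t ≤ k) :
    IsHead (x t '' c.act t) (x t c.head) := by
  refine ⟨⟨_, c.head_mem t h1 hk, rfl⟩, ?_⟩
  rintro _ ⟨m, hm, rfl⟩ hmh _ ⟨m', hm', rfl⟩ hmh'
  have e1 := c.dist_le t h1 hk m hm (fun e => hmh (by rw [e]))
  have e2 := c.dist_le t h1 hk m' hm' (fun e => hmh' (by rw [e]))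
  have e3 := c.dist_head t h1 hk
  have e4 := dist_triangle_right (x t m) (x t m') (c.center t)
  have e5 := dist_triangle_left (x t c.head) (c.center t) (x t m)
  have := c.size_pos t
  linarith

lemma cluster_eq (c : Choreography ε s N k x) (t : ℕ) (i : Fin s) :
    c.cluster t i = (fun z => (rotor s (i + 1) : ℂ) * z) '' (x t '' c.act t) := by
  ext z
  constructor
  · rintro ⟨⟨i', m⟩, ⟨hi, hm⟩, rfl⟩
    simp only at hi hm
    subst hi
    exact ⟨_, ⟨m, hm, rfl⟩, rfl⟩
  · rintro ⟨_, ⟨m, hm, rfl⟩, rfl⟩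
    exact ⟨(i, m), ⟨rfl, hm⟩, rfl⟩

lemma isHead_cluster (c : Choreography ε s N k x) {t : ℕ} (h1 : 1 ≤ t) (hk : t ≤ k) (i : Fin s) :
    IsHead (c.cluster t i) (place s x t (i, c.head)) := by
  rw [cluster_eq]
  exact (c.isHead_act h1 hk).image (Isometry.of_dist_eq fun a b => dist_circle_mul _ a b)

lemma injective_x (c : Choreography ε s N k x) {t : ℕ} (hk : t ≤ k) (i : Fin s) :
    Function.Injective (x t) := by
  intro m m' h
  have : place s x t (i, m) = place s x t (i, m') := by simp only [place, h]
  exact congrArg Prod.snd (c.inj t hk this)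

lemma exists_mem_cluster (c : Choreography ε s N k x) {t : ℕ} (h1 : 1 ≤ t) (hk : t ≤ k)
    (i : Fin s) (y y' : ℂ) : ∃ z ∈ c.cluster t i, z ≠ y ∧ z ≠ y' := by
  obtain ⟨l, hl, -, -⟩ := c.exists_act t h1 hk c.head c.head
  have key : ∀ y : ℂ, ∃ m : Fin N, ∀ l, place s x t (i, l) = y → l = m := by
    intro y
    by_cases h : ∃ m, place s x t (i, m) = y
    · obtain ⟨m, rfl⟩ := h
      exact ⟨m, fun l h => congrArg Prod.snd (c.inj t hk h)⟩
    · exact ⟨l, fun l' h' => absurd ⟨l', h'⟩ h⟩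
  obtain ⟨m, hm⟩ := key y
  obtain ⟨m', hm'⟩ := key y'
  obtain ⟨l, hl, h, h'⟩ := c.exists_act t h1 hk m m'
  exact ⟨_, ⟨(i, l), ⟨rfl, hl⟩, rfl⟩, fun e => h (hm l e), fun e => h' (hm' l e)⟩

/-- The neighbours of an active robot are exactly those in its cluster. -/
lemma mem_cluster_of_matches (c : Choreography ε s N k x) {t t' : ℕ} (h1 : 1 ≤ t) (hk : t ≤ k)
    (h1' : 1 ≤ t') (hk' : t' ≤ k) {b b' : Fin s × Fin N} (hb : b.2 ∈ c.act t) {w : Circle}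
    (hM : Matches (place s x t) b (place s x t') b' w) :
    b'.2 ∈ c.act t' ∧ ∀ z ∈ c.cluster t b.1,
      (w : ℂ) * (z - place s x t b) + place s x t' b' ∈ c.cluster t' b'.1 := by
  have main : ∀ a, a.1 = b.1 → a.2 ∈ c.act t → a ≠ b → b'.2 ∈ c.act t' ∧
      (w : ℂ) * (place s x t a - place s x t b) + place s x t' b' ∈ c.cluster t' b'.1 := by
    intro a ha1 ha2 hab
    have hd := c.dist_act_act h1 hk ha2 hb ha1
    obtain ⟨a', -, heq⟩ := hM a (hd.le.trans c.maxSize_le_one)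
    have hd' : dist (place s x t' a') (place s x t' b') = dist (place s x t a) (place s x t b) := by
      rw [dist_eq_norm, heq, norm_mul, Circle.norm_coe, one_mul, ← dist_eq_norm]
    have hne : a' ≠ b' := by
      rintro rfl
      rw [dist_self, eq_comm, dist_eq_zero] at hd'
      exact hab (c.inj t hk hd')
    -- Only robots of a common cluster are this close, so the image pair lies in one cluster too.
    have hact : a'.1 = b'.1 ∧ a'.2 ∈ c.act t' ∧ b'.2 ∈ c.act t' := by
      by_contra h
      have := c.separated t' h1' hk' a' b' hne h
      linarith
    refine ⟨hact.2.2, ?_⟩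
    rw [← heq, sub_add_cancel]
    exact ⟨a', ⟨hact.1, hact.2.1⟩, rfl⟩
  obtain ⟨l, hl, hlb, -⟩ := c.exists_act t h1 hk b.2 b.2
  have hb' := (main (b.1, l) rfl hl (fun e => hlb (by rw [← e]))).1
  refine ⟨hb', ?_⟩
  rintro _ ⟨a, ⟨ha1, ha2⟩, rfl⟩
  by_cases hab : a = b
  · rw [hab, sub_self, mul_zero, zero_add]
    exact ⟨b', ⟨rfl, hb'⟩, rfl⟩
  · exact (main a ha1 ha2 hab).2

lemma place_succ_sub (t : ℕ) (b : Fin s × Fin N) :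
    place s x (t + 1) b - place s x t b =
      (rotor s (b.1 + 1) : ℂ) * (x (t + 1) b.2 - x t b.2) := by
  simp only [place]; ring

/-- The two matches make `g` an isometry of one cluster onto the other, and it must respect heads.
Hence the times agree, then the rotation is the one between the two formations, and finally
injectivity shows that the two robots have the same role. -/
lemma consistent_cluster (c : Choreography ε s N k x) {t t' : ℕ} (h1 : 1 ≤ t) (hk : t ≤ k)
    (h1' : 1 ≤ t') (hk' : t' ≤ k) {b b' : Fin s × Fin N} (hb : b.2 ∈ c.act t) {w : Circle}
    (hM : Matches (place s x t) b (place s x t') b' w)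
    (hM' : Matches (place s x t') b' (place s x t) b w⁻¹) :
    place s x (t' + 1) b' - place s x t' b' =
      (w : ℂ) * (place s x (t + 1) b - place s x t b) := by
  obtain ⟨hb', hsub⟩ := c.mem_cluster_of_matches h1 hk h1' hk' hb hM
  have hsub' := (c.mem_cluster_of_matches h1' hk' h1 hk hb' hM').2
  obtain ⟨i, m⟩ := b
  obtain ⟨i', m'⟩ := b'
  simp only at hb hb' hsub hsub'
  set y := place s x t (i, m) with hy
  set y' := place s x t' (i', m') with hy'
  set g : ℂ → ℂ := fun z => (w : ℂ) * (z - y) + y' with hg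
  have hgiso : Isometry g := isometry_rigid w y y'
  have himg : g '' c.cluster t i = c.cluster t' i' := by
    refine Set.Subset.antisymm ?_ ?_
    · rintro _ ⟨z, hz, rfl⟩
      exact hsub z hz
    · intro z hz
      refine ⟨_, hsub' z hz, ?_⟩
      simp only [hg, Circle.coe_inv]
      field_simp [Circle.coe_ne_zero w]
      ring
  have hhead : g (place s x t (i, c.head)) = place s x t' (i', c.head) := by
    refine IsHead.unique (c.exists_mem_cluster h1' hk' i') ?_ (c.isHead_cluster h1' hk' i')
    rw [← himg]
    exact (c.isHead_cluster h1 hk i).image hgiso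
  -- the distances to the head reveal the time
  have htime : t = t' := by
    obtain ⟨l, hl, hlh, -⟩ := c.exists_act t h1 hk c.head c.head
    obtain ⟨⟨i'', l'⟩, ⟨hi', hl'⟩, heq⟩ : g (place s x t (i, l)) ∈ c.cluster t' i' := by
      rw [← himg]; exact ⟨_, ⟨(i, l), ⟨rfl, hl⟩, rfl⟩, rfl⟩
    simp only at hi' hl'
    subst hi'
    have hd : dist (x t' l') (x t' c.head) = dist (x t l) (x t c.head) := by
      rw [← dist_place t' i'', ← dist_place t i, heq, ← hhead, hgiso.dist_eq]
    have hlh' : l' ≠ c.head := by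
      rintro rfl
      rw [dist_self, eq_comm, dist_eq_zero] at hd
      exact hlh (c.injective_x hk i hd)
    -- The distance of a follower to the head is between 9/10 and 11/10 of the size. Since sizes at
    -- least halve, these intervals are disjoint for different times.
    have e1 := c.dist_le t h1 hk l hl hlh
    have e1' := c.dist_le t' h1' hk' l' hl' hlh'
    have e2 := c.dist_head t h1 hk
    have e2' := c.dist_head t' h1' hk'
    have e3 := dist_triangle_right (x t l) (x t c.head) (c.center t)
    have e3' := dist_triangle_right (x t' l') (x t' c.head) (c.center t')
    have e4 := dist_triangle_left (x t c.head) (c.center t) (x t l)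
    have e4' := dist_triangle_left (x t' c.head) (c.center t') (x t' l')
    have e5 := c.size_pos t
    have e5' := c.size_pos t'
    rcases lt_trichotomy t t' with h | h | h
    · have := c.size_lt t t' h
      linarith
    · exact h
    · have := c.size_lt t' t h
      linarith
  subst htime
  have hρ := rotor_ne_zero s (i + 1)
  have hρ' := rotor_ne_zero s (i' + 1)
  -- the rotation is the one that takes one formation to the other
  have hw : (rotor s (i' + 1))⁻¹ * w * rotor s (i + 1) = 1 := by
    obtain ⟨l, hl, hlh, -⟩ := c.exists_act t h1 hk c.head c.head
    refine (c.isHead_act h1 hk).eq_one ((Set.toFinite _).image _) ⟨l, hl, rfl⟩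
      (fun e => hlh (c.injective_x hk i e)) ?_
    rintro _ ⟨l, hl, rfl⟩
    have hmem : g (place s x t (i, l)) ∈ c.cluster t i' := by
      rw [← himg]; exact ⟨_, ⟨(i, l), ⟨rfl, hl⟩, rfl⟩, rfl⟩
    rw [cluster_eq] at hmem
    obtain ⟨z, hz, hzeq⟩ := hmem
    convert hz using 1
    have h2 : g (place s x t (i, l)) - g (place s x t (i, c.head)) =
        w * (place s x t (i, l) - place s x t (i, c.head)) := by
      simp only [hg]; ring
    rw [hhead, ← hzeq] at h2
    simp only [place] at h2
    apply mul_left_cancel₀ hρ'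
    rw [Circle.coe_mul, Circle.coe_mul, Circle.coe_inv]
    field_simp
    linear_combination -h2
  have hw' : (w : ℂ) * rotor s (i + 1) = rotor s (i' + 1) := by
    rw [mul_assoc, inv_mul_eq_one] at hw
    rw [← Circle.coe_mul, ← hw]
  have hmm : m = m' := by
    apply c.injective_x hk i
    apply mul_left_cancel₀ hρ'
    simp only [hg, hy, hy', place] at hhead
    linear_combination (x t c.head - x t m) * hw' - hhead
  subst hmm
  rw [place_succ_sub, place_succ_sub, ← mul_assoc, hw']

end Choreography

/-! ### Recognising the initial and the final configuration -/

lemma Matches.dist_eq {Λ : Type} {Y Y' : Λ → ℂ} {b b' : Λ} {w : Circle}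
    (hM : Matches Y b Y' b' w) {a₁ a₂ : Λ} (h₁ : dist (Y a₁) (Y b) ≤ 1)
    (h₂ : dist (Y a₂) (Y b) ≤ 1) :
    ∃ a₁' a₂', dist (Y' a₁') (Y' a₂') = dist (Y a₁) (Y a₂) := by
  obtain ⟨a₁', -, e₁⟩ := hM a₁ h₁
  obtain ⟨a₂', -, e₂⟩ := hM a₂ h₂
  refine ⟨a₁', a₂', ?_⟩
  have : Y' a₁' - Y' a₂' = w * (Y a₁ - Y a₂) := by linear_combination e₁ - e₂
  rw [dist_eq_norm, this, norm_mul, Circle.norm_coe, one_mul, ← dist_eq_norm]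

lemma sum_rotor_eq_zero {s : ℕ} (hs : 2 ≤ s) : ∑ i : Fin s, (rotor s (i + 1) : ℂ) = 0 := by
  have h := (Complex.isPrimitiveRoot_exp s (by omega)).geom_sum_eq_zero (by omega)
  rw [← Fin.sum_univ_eq_sum_range] at h
  rw [← h]
  refine Finset.sum_congr rfl fun i _ => ?_
  rw [rotor_succ, Circle.coe_pow, Circle.coe_exp]
  congr 2
  push_cast; ring

namespace Choreography

variable {ε : ℝ} {s N k : ℕ} {x : ℕ → Fin N → ℂ}

lemma sum_place_zero (hs : 2 ≤ s) (t : ℕ) : ∑ b : Fin s × Fin N, place s x t b = 0 := by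
  rw [Fintype.sum_prod_type]
  simp only [place]
  simp_rw [← Finset.mul_sum]
  rw [← Finset.sum_mul, sum_rotor_eq_zero hs, zero_mul]

/-- Every robot sees all others, so a match is an isometric permutation of the whole configuration
and sends a pair at distance ε to such a pair. If it keeps the order of the pair, it is the rotation
between two formations and preserves roles; a reversed pair is impossible. -/
lemma consistent_initial (c : Choreography ε s N k x) {b b' : Fin s × Fin N} {w : Circle}
    (hM : Matches (place s x 0) b (place s x 0) b' w) :
    place s x 1 b' - place s x 0 b' = (w : ℂ) * (place s x 1 b - place s x 0 b) := by
  have hε := c.eps_pos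
  choose π hπ using fun a => (hM a (c.visible a b)).imp fun _ h => h.2
  obtain ⟨i, m⟩ := b
  have hdist : ∀ a₁ a₂, dist (place s x 0 (π a₁)) (place s x 0 (π a₂)) =
      dist (place s x 0 a₁) (place s x 0 a₂) := by
    intro a₁ a₂
    have : place s x 0 (π a₁) - place s x 0 (π a₂) = w * (place s x 0 a₁ - place s x 0 a₂) := by
      linear_combination hπ a₁ - hπ a₂
    rw [dist_eq_norm, this, norm_mul, Circle.norm_coe, one_mul, ← dist_eq_norm]
  have hinj : Function.Injective π := by
    intro a₁ a₂ h
    have := hdist a₁ a₂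
    rw [h, dist_self, eq_comm, dist_eq_zero] at this
    exact c.inj 0 (Nat.zero_le _) this
  have hpair : dist (place s x 0 (i, c.first)) (place s x 0 (i, c.second)) = ε := by
    rw [dist_place, c.first_eq, c.second_eq, dist_eq_norm, sub_add_cancel_left, norm_neg,
      Complex.norm_real, Real.norm_of_nonneg hε.le]
  obtain ⟨hi, hor⟩ := c.eps_pair (π (i, c.first)) (π (i, c.second)) (by rw [hdist, hpair])
  have hεne : (ε : ℂ) ≠ 0 := by exact_mod_cast hε.ne'
  have hf := hπ (i, c.first)
  have hsd := hπ (i, c.second)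
  rcases hor with ⟨h1, h2⟩ | ⟨h1, h2⟩
  · -- the match takes one formation to the other
    obtain ⟨⟨j, n⟩, hj⟩ : ∃ q, q = π (i, c.first) := ⟨_, rfl⟩
    have e1 : π (i, c.first) = (j, c.first) :=
      Prod.ext (congrArg Prod.fst hj).symm h1
    have e2 : π (i, c.second) = (j, c.second) :=
      Prod.ext (hi.symm.trans (congrArg Prod.fst hj).symm) h2
    rw [e1] at hf
    rw [e2] at hsd
    simp only [place, c.first_eq, c.second_eq] at hf hsd
    have hw : (rotor s (j + 1) : ℂ) = w * rotor s (i + 1) := by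
      apply mul_right_cancel₀ hεne
      linear_combination hsd - hf
    have hb' : (j, m) = b' := by
      apply c.inj 0 (Nat.zero_le _)
      simp only [place] at hf ⊢
      linear_combination hf + (x 0 m - c.anchor) * hw
    rw [← hb', place_succ_sub, place_succ_sub, ← mul_assoc, ← hw]
  · exfalso
    obtain ⟨⟨j, n⟩, hj⟩ : ∃ q, q = π (i, c.first) := ⟨_, rfl⟩
    have e1 : π (i, c.first) = (j, c.second) :=
      Prod.ext (congrArg Prod.fst hj).symm h1
    have e2 : π (i, c.second) = (j, c.first) :=
      Prod.ext (hi.symm.trans (congrArg Prod.fst hj).symm) h2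
    rw [e1] at hf
    rw [e2] at hsd
    simp only [place, c.first_eq, c.second_eq] at hf hsd
    have hw : (w : ℂ) * rotor s (i + 1) = -rotor s (j + 1) := by
      apply mul_right_cancel₀ hεne
      linear_combination hf - hsd
    -- the match is a rotation by `π` followed by a rotation about the origin
    have hg : ∀ a, place s x 0 (π a) =
        w * place s x 0 a + rotor s (j + 1) * (2 * c.anchor + ε) := by
      intro a
      simp only [place] at hf ⊢
      have := hπ a
      simp only [place] at this
      linear_combination this - hf - c.anchor * hw
    rcases Nat.lt_or_ge 1 s with hs | hs
    · have hbij : Function.Bijective π := Finite.injective_iff_bijective.1 hinj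
      -- By symmetry all positions sum to zero, so summing `hg` forces its translation part to
      -- vanish; but `2 * anchor + ε` has positive imaginary part.
      have hsum := hbij.sum_comp (fun a => place s x 0 a)
      simp only [hg] at hsum
      rw [Finset.sum_add_distrib, ← Finset.mul_sum, sum_place_zero hs, mul_zero, zero_add,
        Finset.sum_const, smul_eq_zero, mul_eq_zero] at hsum
      have hcard : (Finset.univ : Finset (Fin s × Fin N)).card ≠ 0 :=
        Finset.card_ne_zero_of_mem (Finset.mem_univ (i, m))
      have him := c.anchor_im_pos hs
      have := (hsum.resolve_left hcard).resolve_left (rotor_ne_zero _ _)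
      have := congrArg Complex.im this
      rw [Complex.add_im, Complex.ofReal_im, Complex.zero_im, add_zero, Complex.mul_im] at this
      simp at this
      linarith
    · have hi0 : (i : ℕ) = 0 := by omega
      have hj0 : (j : ℕ) = 0 := by omega
      have hs1 : s = 1 := by have := i.2; omega
      -- With one formation the match is a half turn that swaps the pair. It sends the third
      -- defining robot to `anchor + ε - far`, to the left of every robot.
      have h3 := hg (i, c.third)
      have hq : ((π (i, c.third)).1 : ℕ) = 0 := by have := (π (i, c.third)).1.2; omega
      simp only [place, hi0, hj0, hq, zero_add, rotor_one, Circle.coe_one, one_mul, mul_one,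
        c.third_eq] at h3 hw
      have hre := c.anchor_re_le (π (i, c.third)).2
      rw [h3, hw] at hre
      simp at hre
      linarith [c.lt_far]

/-- An initial snapshot shows all robots as distinct points. A later robot with as many points in
view would see an entire cluster, whose distances are below the minimum distance ε of the start. -/
lemma not_snapshot_eq_of_initial (c : Choreography ε s N k x) {t : ℕ} (h1 : 1 ≤ t) (hk : t ≤ k)
    {b b' : Fin s × Fin N} {u u' : Circle} :
    snapshot (place s x 0) b u ≠ snapshot (place s x t) b' u' := by
  intro h
  have hcard := card_le_ncard_snapshot (c.inj 0 (Nat.zero_le _)) (fun a => c.visible a b) u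
  rw [h] at hcard
  have hle := hcard.trans (ncard_snapshot_le (place s x t) b' u')
  have huniv : {a | dist (place s x t a) (place s x t b') ≤ 1} = Set.univ := by
    refine Set.eq_of_subset_of_ncard_le (Set.subset_univ _) ?_
    rwa [Set.ncard_univ, Nat.card_eq_fintype_card]
  have hvis : ∀ a, dist (place s x t a) (place s x t b') ≤ 1 := fun a =>
    (huniv ▸ Set.mem_univ a : a ∈ {a | dist (place s x t a) (place s x t b') ≤ 1})
  obtain ⟨l, hl, hlh, -⟩ := c.exists_act t h1 hk c.head c.head
  obtain ⟨a₁, a₂, hd⟩ := (matches_of_snapshot_eq h.symm).dist_eq (hvis (b.1, l))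
    (hvis (b.1, c.head))
  have hlt := c.dist_act_act h1 hk (b := (b.1, l)) (b' := (b.1, c.head)) hl (c.head_mem t h1 hk) rfl
  have hne : a₁ ≠ a₂ := by
    rintro rfl
    rw [dist_self, eq_comm, dist_eq_zero] at hd
    exact hlh (congrArg Prod.snd (c.inj t hk hd))
  have := c.sep a₁ a₂ hne
  linarith [c.maxSize_le]

/-- A configuration with all distances greater than `ε` does not look like an earlier one. -/
lemma not_matches_of_lt_dist (c : Choreography ε s N k x) {t : ℕ} (hk : t ≤ k)
    {b b' : Fin s × Fin N} (hb : 1 ≤ t → b.2 ∈ c.act t) {Y : Fin s × Fin N → ℂ}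
    (hY : ∀ a a', a ≠ a' → ε < dist (Y a) (Y a')) {w : Circle} :
    ¬ Matches (place s x t) b Y b' w := by
  intro hM
  have key : ∀ a₁ a₂, a₁ ≠ a₂ → dist (place s x t a₁) (place s x t b) ≤ 1 →
      dist (place s x t a₂) (place s x t b) ≤ 1 →
      ¬ dist (place s x t a₁) (place s x t a₂) ≤ ε := by
    intro a₁ a₂ hne h₁ h₂ h
    obtain ⟨a₁', a₂', hd⟩ := hM.dist_eq h₁ h₂
    have hne' : a₁' ≠ a₂' := by
      rintro rfl
      rw [dist_self, eq_comm, dist_eq_zero] at hd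
      exact hne (c.inj t hk hd)
    exact absurd (hY _ _ hne') (not_lt.2 (hd.le.trans h))
  -- A moving robot sees a pair at distance at most ε: initially an anchor and its neighbour, later
  -- itself and a cluster mate.
  rcases Nat.eq_zero_or_pos t with rfl | h1
  · have hpair : dist (place s x 0 (b.1, c.first)) (place s x 0 (b.1, c.second)) = ε := by
      rw [dist_place, c.first_eq, c.second_eq, dist_eq_norm, sub_add_cancel_left, norm_neg,
        Complex.norm_real, Real.norm_of_nonneg c.eps_pos.le]
    refine key _ _ ?_ (c.visible _ _) (c.visible _ _) hpair.le
    intro e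
    rw [e, dist_self] at hpair
    exact c.eps_pos.ne hpair
  · obtain ⟨l, hl, hlb, -⟩ := c.exists_act t h1 hk b.2 b.2
    have hlt := c.dist_act_act h1 hk (b := (b.1, l)) (b' := b) hl (hb h1) rfl
    refine key (b.1, l) b (fun e => hlb (by rw [← e])) (by linarith [c.maxSize_le_one])
      (by rw [dist_self]; exact zero_le_one) (by linarith [c.maxSize_le])

/-- Moves at times after `k` enter the table only if `stable` holds. Otherwise a final snapshot
could coincide with one in which a robot has to move. -/
theorem exists_protocol (c : Choreography ε s N k x) {stable : Prop}
    (hfin : stable → ∀ t, k < t → ∀ a a', a ≠ a' → ε < dist (place s x t a) (place s x t a'))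
    (hstep : ∀ t ≤ k, ∀ m, ‖x (t + 1) m - x t m‖ ≤ 1) :
    ∃ A : Protocol, ∀ (ι : Type) (R : ι → ℂ) (φ : ι → Fin s × Fin N), Function.Surjective φ →
      R = place s x 0 ∘ φ → ∀ (u : ℕ → ι → Circle) (t : ℕ), (t ≤ k + 1 ∨ stable) →
      A.run u R t = place s x t ∘ φ := by
  refine Exists.imp (fun A hA ι R φ hφ hR u t ht => hA ι R φ hφ hR u t fun t' ht' => ?_)
    (Drawing.exists_protocol (place s x) (fun t => t ≤ k ∨ stable) ?_ ?_)
  · intro t _ b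
    rw [place_succ_sub, norm_mul, Circle.norm_coe, one_mul]
    rcases Nat.lt_or_ge k t with h | h
    · rw [c.rest_end t h]; simp
    · exact hstep t h _
  · -- resting robots
    have hrest : ∀ t (b : Fin s × Fin N), ¬ (t ≤ k ∧ (1 ≤ t → b.2 ∈ c.act t)) →
        place s x (t + 1) b - place s x t b = 0 := by
      intro t b h
      rw [place_succ_sub]
      rcases Nat.lt_or_ge k t with hk | hk
      · rw [c.rest_end t hk, sub_self, mul_zero]
      · have : ¬ (1 ≤ t → b.2 ∈ c.act t) := fun h' => h ⟨hk, h'⟩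
        push Not at this
        rw [c.rest t this.1 hk _ this.2, sub_self, mul_zero]
    -- a moving robot at time `t` and an arbitrary robot at time `t'`
    have main : ∀ t t', (t' ≤ k ∨ stable) → ∀ b b' (u u' : Circle),
        t ≤ k → (1 ≤ t → b.2 ∈ c.act t) →
        snapshot (place s x t) b u = snapshot (place s x t') b' u' →
        ((u⁻¹ : Circle) : ℂ) * (place s x (t + 1) b - place s x t b) =
          ((u'⁻¹ : Circle) : ℂ) * (place s x (t' + 1) b' - place s x t' b') := by
      intro t t' hgood b b' u u' hk hb h
      have hM := matches_of_snapshot_eq h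
      have hM' := matches_of_snapshot_eq h.symm
      rcases Nat.lt_or_ge k t' with hk' | hk'
      · exact absurd hM (c.not_matches_of_lt_dist hk hb
          (hfin (hgood.resolve_left (by omega)) t' hk'))
      have suff : place s x (t' + 1) b' - place s x t' b' =
          ((u' * u⁻¹ : Circle) : ℂ) * (place s x (t + 1) b - place s x t b) := by
        rcases Nat.eq_zero_or_pos t with rfl | h1
        · rcases Nat.eq_zero_or_pos t' with rfl | h1'
          · exact c.consistent_initial hM
          · exact absurd h (c.not_snapshot_eq_of_initial h1' hk')
        · rcases Nat.eq_zero_or_pos t' with rfl | h1'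
          · exact absurd h.symm (c.not_snapshot_eq_of_initial h1 hk)
          · refine c.consistent_cluster h1 hk h1' hk' (hb h1) hM ?_
            rwa [mul_inv_rev, inv_inv]
      rw [suff, ← mul_assoc, ← Circle.coe_mul, inv_mul_cancel_left]
    intro t t' hg hg' b b' u u' h
    by_cases ha : t ≤ k ∧ (1 ≤ t → b.2 ∈ c.act t)
    · exact main t t' hg' b b' u u' ha.1 ha.2 h
    by_cases ha' : t' ≤ k ∧ (1 ≤ t' → b'.2 ∈ c.act t')
    · exact (main t' t hg b' b u' u ha'.1 ha'.2 h.symm).symm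
    · rw [hrest t b ha, hrest t' b' ha', mul_zero, mul_zero]
  · rcases ht with ht | ht
    · exact Or.inl (by omega)
    · exact Or.inr ht

end Choreography

/-! ### Granular states -/

/-- The points of the granular grid with anchor `a` and direction `1`. -/
def grid (a : ℂ) (ε : ℝ) : Set ℂ :=
  {z | z = a ∨ ∃ i j : ℕ, z = a + ((1 + 2 * (i : ℝ)) * ε : ℝ) + (2 * (j : ℝ) * ε : ℝ) * Complex.I}

lemma norm_sq_of_im_re (a b : ℝ) : ‖(a : ℂ) + (b : ℂ) * Complex.I‖ ^ 2 = a ^ 2 + b ^ 2 := by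
  rw [← Complex.normSq_eq_norm_sq, Complex.normSq_add_mul_I]

lemma grid_anchor {a : ℂ} {ε : ℝ} (hε : 0 < ε) (i j : ℕ) {z : ℂ}
    (hz : z = a + ((1 + 2 * (i : ℝ)) * ε : ℝ) + (2 * (j : ℝ) * ε : ℝ) * Complex.I) :
    ε ≤ dist z a ∧ (dist z a = ε → z = a + ε) := by
  have hsq : dist z a ^ 2 = ((1 + 2 * (i : ℝ)) * ε) ^ 2 + (2 * (j : ℝ) * ε) ^ 2 := by
    rw [dist_eq_norm, hz, add_assoc, add_sub_cancel_left, norm_sq_of_im_re]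
  have hi : (0 : ℝ) ≤ i := Nat.cast_nonneg i
  have h1 : ε ^ 2 ≤ ((1 + 2 * (i : ℝ)) * ε) ^ 2 := by
    apply pow_le_pow_left₀ hε.le
    nlinarith
  constructor
  · refine le_of_sq_le_sq ?_ dist_nonneg
    rw [hsq]
    nlinarith [sq_nonneg (2 * (j : ℝ) * ε)]
  · intro h
    rw [h] at hsq
    have hi0 : (i : ℝ) = 0 := by
      by_contra hne
      have : 0 < (i : ℝ) := lt_of_le_of_ne hi (Ne.symm hne)
      nlinarith [sq_nonneg (2 * (j : ℝ) * ε), mul_pos this (pow_pos hε 2)]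
    have hj0 : (j : ℝ) = 0 := by
      have : (2 * (j : ℝ) * ε) ^ 2 = 0 := by nlinarith [sq_nonneg (2 * (j : ℝ) * ε)]
      have := pow_eq_zero_iff (two_ne_zero) |>.1 this
      rcases mul_eq_zero.1 this with h | h
      · linarith
      · exact absurd h hε.ne'
    rw [hz, hi0, hj0]
    simp

lemma two_mul_le_dist_grid {a : ℂ} {ε : ℝ} (i j i' j' : ℕ) {z z' : ℂ}
    (hz : z = a + ((1 + 2 * (i : ℝ)) * ε : ℝ) + (2 * (j : ℝ) * ε : ℝ) * Complex.I)
    (hz' : z' = a + ((1 + 2 * (i' : ℝ)) * ε : ℝ) + (2 * (j' : ℝ) * ε : ℝ) * Complex.I)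
    (hne : z ≠ z') : 2 * ε ≤ dist z z' := by
  have hsq : dist z z' ^ 2 = (2 * ε) ^ 2 * (((i : ℝ) - i') ^ 2 + ((j : ℝ) - j') ^ 2) := by
    have : z - z' = ((2 * ε * ((i : ℝ) - i') : ℝ) : ℂ) +
        ((2 * ε * ((j : ℝ) - j') : ℝ) : ℂ) * Complex.I := by
      rw [hz, hz']; push_cast; ring
    rw [dist_eq_norm, this, norm_sq_of_im_re]
    ring
  have h1 : (1 : ℝ) ≤ ((i : ℝ) - i') ^ 2 + ((j : ℝ) - j') ^ 2 := by
    have : (0 : ℤ) < ((i : ℤ) - i') ^ 2 + ((j : ℤ) - j') ^ 2 := by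
      by_contra hcon
      push Not at hcon
      have e1 : ((i : ℤ) - i') ^ 2 = 0 := by nlinarith [sq_nonneg ((i : ℤ) - i'), sq_nonneg ((j : ℤ) - j')]
      have e2 : ((j : ℤ) - j') ^ 2 = 0 := by nlinarith [sq_nonneg ((i : ℤ) - i'), sq_nonneg ((j : ℤ) - j')]
      have e1 := pow_eq_zero_iff (two_ne_zero) |>.1 e1
      have e2 := pow_eq_zero_iff (two_ne_zero) |>.1 e2
      obtain rfl : i = i' := by omega
      obtain rfl : j = j' := by omega
      exact hne (hz.trans hz'.symm)
    exact_mod_cast this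
  refine le_of_sq_le_sq ?_ dist_nonneg
  rw [hsq]
  nlinarith [sq_nonneg (2 * ε)]

/-- Relative to the anchor, the other grid points have odd abscissae and even ordinates in units of
ε. They are thus 2ε apart, and distance ε needs the anchor. -/
lemma grid_dist {a : ℂ} {ε : ℝ} (hε : 0 < ε) {z z' : ℂ} (hz : z ∈ grid a ε) (hz' : z' ∈ grid a ε)
    (hne : z ≠ z') : ε ≤ dist z z' ∧
      (dist z z' = ε → (z = a ∧ z' = a + ε) ∨ (z = a + ε ∧ z' = a)) := by
  rcases hz with rfl | ⟨i, j, hz⟩ <;> rcases hz' with rfl | ⟨i', j', hz'⟩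
  · exact absurd rfl hne
  · rw [dist_comm]
    obtain ⟨h1, h2⟩ := grid_anchor hε i' j' hz'
    exact ⟨h1, fun h => Or.inl ⟨rfl, h2 h⟩⟩
  · obtain ⟨h1, h2⟩ := grid_anchor hε i j hz
    exact ⟨h1, fun h => Or.inr ⟨h2 h, rfl⟩⟩
  · have := two_mul_le_dist_grid i j i' j' hz hz' hne
    exact ⟨by linarith, fun h => by linarith⟩

lemma re_le_of_mem_grid {a : ℂ} {ε : ℝ} (hε : 0 < ε) {z : ℂ} (hz : z ∈ grid a ε) : a.re ≤ z.re := by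
  rcases hz with rfl | ⟨i, j, rfl⟩
  · exact le_rfl
  · simp only [Complex.add_re, Complex.ofReal_re, Complex.re_ofReal_mul, Complex.I_re]
    have : 0 ≤ (1 + 2 * (i : ℝ)) * ε := by positivity
    linarith

/-- A granular state of a hull with direction `1` consists of grid points, and contains the three
defining ones. -/
lemma granularStates_subset_grid {H : DrawingHull} (hd : H.dir = 1) {ε : ℝ} (hε : 0 < ε)
    {U : Set ℂ} (hU : U ∈ H.granularStates ε) :
    U ⊆ grid H.anchor ε ∧ H.anchor ∈ U ∧ H.anchor + (ε : ℂ) ∈ U ∧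
      ∃ far : ℝ, ε < far ∧ H.anchor + (far : ℂ) ∈ U := by
  obtain ⟨S, T, hS, ⟨i, hi, rfl⟩, rfl⟩ := hU
  rw [Finset.mem_Icc] at hi
  rw [hd]
  have hi1 : (1 : ℝ) ≤ i := by exact_mod_cast hi.1
  refine ⟨?_, Or.inr (by simp), Or.inr (by simp), (1 + 2 * (i : ℝ)) * ε, by nlinarith,
    Or.inr (by simp)⟩
  rintro z (hz | rfl | rfl | rfl)
  · rcases (hS hz).1 with rfl | ⟨i', j', h⟩
    · exact Or.inl rfl
    · right
      refine ⟨i', j', ?_⟩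
      rw [h, hd]
      simp
  · exact Or.inl rfl
  · exact Or.inr ⟨0, 0, by simp⟩
  · exact Or.inr ⟨i, 0, by simp⟩

/-! ### Hulls -/

lemma rotor_mul_mem_moveTo {H : DrawingHull} {s i : ℕ} {z q : ℂ} :
    (rotor s i : ℂ) * z ∈ ((formationHull H s i).moveTo ((rotor s i : ℂ) * q)).carrier ↔
      z ∈ (H.moveTo q).carrier := by
  simp only [DrawingHull.carrier, DrawingHull.moveTo, formationHull, DrawingHull.rigid,
    Set.mem_ofPred_eq]
  rw [dist_circle_mul, ← mul_sub, ccwAngle_mul_left (rotor_ne_zero s i)]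

lemma formationHull_anchor (H : DrawingHull) (s i : ℕ) :
    (formationHull H s i).anchor = (rotor s i : ℂ) * H.anchor := add_zero _

lemma carrier_formationHull {H : DrawingHull} {s i : ℕ} {z : ℂ} :
    (rotor s i : ℂ) * z ∈ (formationHull H s i).carrier ↔ z ∈ H.carrier := by
  have := rotor_mul_mem_moveTo (H := H) (s := s) (i := i) (z := z) (q := H.anchor)
  rwa [← formationHull_anchor] at this

lemma formationHull_one (H : DrawingHull) (s : ℕ) : formationHull H s 1 = H := by
  obtain ⟨a, d, φ, Δ, h1, h2, h3⟩ := H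
  simp [formationHull, DrawingHull.rigid, rotor_one]

lemma IsAligned.dir_eq {H : DrawingHull} {s : ℕ} (h : IsAligned H s 1) : H.dir = 1 := by
  refine eq_one_of_ccwAngle_eq_zero H.norm_dir ?_
  rw [h.1]; norm_num

lemma IsAligned.closedBall_subset {H : DrawingHull} {s : ℕ} (hs : 1 ≤ s) (h : IsAligned H s 1)
    {q z : ℂ} {ε : ℝ} (hq : Metric.closedBall q ε ⊆ openCone s) (hz : z ∈ (H.moveTo q).carrier) :
    Metric.closedBall z ε ⊆ openCone s := by
  have h1 : ccwAngle 1 (z - q) < H.span := by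
    have := hz.2.2
    simp only [DrawingHull.moveTo] at this
    rwa [h.dir_eq] at this
  have := closedBall_add_subset_openCone hs hq (x := z - q)
    (h1.trans_le (h.2 ▸ min_le_left _ _))
  rwa [add_sub_cancel] at this

lemma ofReal_add_mem_moveTo {H : DrawingHull} (hd : H.dir = 1) (q : ℂ) {τ : ℝ} (h0 : 0 ≤ τ)
    (hτ : τ ≤ H.diam) : q + (τ : ℂ) ∈ (H.moveTo q).carrier := by
  refine ⟨?_, ?_⟩
  · simp only [DrawingHull.moveTo]
    rw [dist_eq_norm, add_sub_cancel_left, Complex.norm_real, Real.norm_of_nonneg h0]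
    exact hτ
  · simp only [DrawingHull.moveTo]
    rw [add_sub_cancel_left, hd]
    have : ccwAngle 1 (τ : ℂ) = 0 := by
      rcases h0.lt_or_eq with h | h
      · have := ccwAngle_one_eq h (θ := 0) ⟨le_rfl, Real.two_pi_pos⟩
        simpa using this
      · rw [← h, Complex.ofReal_zero, ccwAngle_one_zero]
    rw [this]
    exact ⟨le_rfl, H.span_mem.1⟩

/-- A hull with direction `1` lies within its diameter of every point that is that far from the
anchor in its direction. -/
lemma dist_ofReal_add_le {H : DrawingHull} (hd : H.dir = 1) {q z : ℂ} (hz : z ∈ (H.moveTo q).carrier)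
    {τ : ℝ} (h0 : 0 ≤ τ) (hτ : τ ≤ H.diam) : dist (z - q) (τ : ℂ) ≤ H.diam := by
  obtain ⟨h1, h2⟩ := hz
  simp only [DrawingHull.moveTo] at h1 h2
  rw [hd] at h2
  rw [dist_eq_norm] at h1
  have hspan := h2.2.trans_le H.span_mem.2
  have hpol := norm_mul_exp_ccwAngle (z - q)
  set r := ‖z - q‖ with hr
  set θ := ccwAngle 1 (z - q)
  -- A span of at most π/3 gives cosine at least 1/2, so the squared distance is at most r² - rτ +
  -- τ², which does not exceed the square of the larger of `r` and `τ`.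
  have hre : r / 2 ≤ (z - q).re := by
    rw [← hpol, Circle.coe_exp, Complex.re_ofReal_mul, Complex.exp_ofReal_mul_I_re]
    have : Real.cos (Real.pi / 3) ≤ Real.cos θ :=
      Real.cos_le_cos_of_nonneg_of_le_pi h2.1 (by linarith [Real.pi_pos]) hspan.le
    rw [Real.cos_pi_div_three] at this
    have hr0 : 0 ≤ r := norm_nonneg _
    nlinarith
  have hsq : dist (z - q) (τ : ℂ) ^ 2 = r ^ 2 - 2 * τ * (z - q).re + τ ^ 2 := by
    rw [dist_eq_norm, hr, ← Complex.normSq_eq_norm_sq, ← Complex.normSq_eq_norm_sq,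
      Complex.normSq_apply, Complex.normSq_apply]
    simp only [Complex.sub_re, Complex.sub_im, Complex.ofReal_re, Complex.ofReal_im]
    ring
  have hr0 : 0 ≤ r := norm_nonneg _
  refine le_of_sq_le_sq ?_ H.diam_mem.1.le
  rw [hsq]
  rcases le_total τ r with h | h
  · nlinarith
  · nlinarith


/-! ### The trajectories of the robots of a formation -/

/-- Zero values are skipped on purpose: a goal may coincide with a path vertex. -/
lemma exists_pos_le {α : Type*} [Finite α] (f : α → ℝ) : ∃ η > 0, ∀ a, 0 < f a → η ≤ f a := by
  have hfin : (f '' {a | 0 < f a}).Finite := (Set.toFinite _).image f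
  rcases (f '' {a | 0 < f a}).eq_empty_or_nonempty with h | h
  · exact ⟨1, one_pos, fun a ha => absurd h (Set.Nonempty.ne_empty ⟨f a, a, ha, rfl⟩)⟩
  · obtain ⟨_, ⟨a, ha, rfl⟩, hmin⟩ := hfin.exists_minimal h
    refine ⟨f a, ha, fun b hb => ?_⟩
    rcases le_total (f a) (f b) with h | h
    · exact h
    · exact hmin ⟨b, hb, rfl⟩ h

/-- The relative distance of a robot from the centre of its cluster. -/
noncomputable def offset {N : ℕ} (h m : Fin N) : ℝ :=
  -- Distinct values in (0, 1/10] for the followers keep the robots of a cluster apart and well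
  -- below the head.
  if m = h then 1 else ((m : ℝ) + 1) / (10 * N)

lemma offset_head {N : ℕ} (h : Fin N) : offset h h = 1 := if_pos rfl

lemma offset_le {N : ℕ} {h m : Fin N} (hm : m ≠ h) : offset h m ≤ 1 / 10 := by
  rw [offset, if_neg hm]
  have h1 : ((m : ℕ) : ℝ) + 1 ≤ N := by exact_mod_cast m.2
  have h0 : (0 : ℝ) < N := by exact_mod_cast m.pos
  rw [div_le_div_iff₀ (by positivity) (by norm_num)]
  linarith

lemma offset_pos {N : ℕ} (h m : Fin N) : 0 < offset h m := by
  unfold offset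
  have h1 : (0 : ℝ) < N := by exact_mod_cast m.pos
  split_ifs <;> positivity

lemma offset_le_one {N : ℕ} (h m : Fin N) : offset h m ≤ 1 := by
  by_cases hm : m = h
  · rw [hm, offset_head]
  · linarith [offset_le hm]

lemma offset_injective {N : ℕ} (h : Fin N) : Function.Injective (offset h) := by
  intro m m' e
  by_cases hm : m = h <;> by_cases hm' : m' = h
  · rw [hm, hm']
  · rw [hm, offset_head] at e
    linarith [offset_le hm']
  · rw [hm', offset_head] at e
    linarith [offset_le hm]
  · rw [offset, offset, if_neg hm, if_neg hm'] at e
    have h1 : (N : ℝ) ≠ 0 := by have := m.pos; positivity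
    field_simp at e
    have : ((m : ℕ) : ℝ) = m' := by linarith
    exact Fin.ext (by exact_mod_cast this)

/-- The unit vector in direction `z` (or `0` if `z = 0`). -/
noncomputable def unitVec (z : ℂ) : ℂ := ((‖z‖⁻¹ : ℝ) : ℂ) * z

lemma norm_unitVec {z : ℂ} (hz : z ≠ 0) : ‖unitVec z‖ = 1 := by
  rw [unitVec, norm_mul, Complex.norm_real, norm_inv, norm_norm,
    inv_mul_cancel₀ (norm_ne_zero_iff.2 hz)]

lemma norm_unitVec_le (z : ℂ) : ‖unitVec z‖ ≤ 1 := by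
  by_cases hz : z = 0
  · simp [hz, unitVec]
  · exact (norm_unitVec hz).le

/-- The difference is parallel to `z` with length | ‖z‖ - τ |, also when `τ` overshoots. -/
lemma norm_sub_mul_unitVec_le {z : ℂ} (hz : ‖z‖ ≤ 1) {τ : ℝ} (h0 : 0 ≤ τ) (h1 : τ ≤ 1) :
    ‖z - (τ : ℂ) * unitVec z‖ ≤ 1 := by
  by_cases h : z = 0
  · simp [h, unitVec]
  have hz' : (‖z‖ : ℂ) ≠ 0 := by exact_mod_cast norm_ne_zero_iff.2 h
  have : z - (τ : ℂ) * unitVec z = ((‖z‖ - τ : ℝ) : ℂ) * unitVec z := by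
    rw [unitVec]; push_cast; field_simp
  rw [this, norm_mul, norm_unitVec h, mul_one, Complex.norm_real, Real.norm_eq_abs, abs_le]
  constructor <;> linarith [norm_nonneg z]

/-- What the trajectories of a formation depend on: the initial positions `start`, the final
positions `goal`, the path `v 1, …, v k`, the index `level m` of the vertex from which robot `m`
reaches its goal, the index `tail` of the first vertex of the tail, a robot `head` that is never
dropped early, and the size `scale` of the clusters. -/
structure Tour (N : ℕ) where
  start : Fin N → ℂ
  goal : Fin N → ℂ
  v : ℕ → ℂ
  k : ℕ
  level : Fin N → ℕ
  tail : ℕ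
  head : Fin N
  scale : ℝ

namespace Tour

variable {N : ℕ}

/-- The vertex at which the formation is at time `t`. -/
def center (p : Tour N) (t : ℕ) : ℂ := p.v (min (t + 1) p.k)

/-- The direction from the centre of the cluster in which robot `m` is placed at time `t`. -/
noncomputable def shift (p : Tour N) (t : ℕ) (m : Fin N) : ℂ :=
  -- At time `k` the formation is at the last vertex for a second cycle, no longer bound to its
  -- hull, and each robot leans towards its own goal so that the final step is at most 1.
  if t < p.k then 1 else unitVec (p.goal m - p.v p.k)

/-- The robots that are not yet dropped at time `t`. -/
def act (p : Tour N) (t : ℕ) : Set (Fin N) := {m | t < p.level m ∨ p.tail ≤ p.level m}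

/-- The size of the cluster at time `t`. -/
noncomputable def size (p : Tour N) (t : ℕ) : ℝ := p.scale / 2 ^ t

open Classical in
/-- The position of robot `m` at time `t`. -/
noncomputable def pos (p : Tour N) (t : ℕ) (m : Fin N) : ℂ :=
  if t = 0 then p.start m
  else if t ≤ p.k ∧ m ∈ p.act t then
    p.center t + (p.size t * offset p.head m : ℝ) * p.shift t m
  else p.goal m

lemma pos_zero (p : Tour N) : p.pos 0 = p.start := by
  funext m; rw [pos, if_pos rfl]

lemma pos_act (p : Tour N) {t : ℕ} (h1 : 1 ≤ t) (hk : t ≤ p.k) {m : Fin N} (hm : m ∈ p.act t) :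
    p.pos t m = p.center t + (p.size t * offset p.head m : ℝ) * p.shift t m := by
  rw [pos, if_neg (by omega), if_pos ⟨hk, hm⟩]

lemma pos_rest (p : Tour N) {t : ℕ} (h1 : 1 ≤ t) {m : Fin N} (hm : ¬ (t ≤ p.k ∧ m ∈ p.act t)) :
    p.pos t m = p.goal m := by
  rw [pos, if_neg (by omega), if_neg hm]

lemma act_anti (p : Tour N) {t t' : ℕ} (h : t ≤ t') : p.act t' ⊆ p.act t := fun _ hm =>
  hm.imp (fun h' => h.trans_lt h') id

lemma norm_shift_le (p : Tour N) (t : ℕ) (m : Fin N) : ‖p.shift t m‖ ≤ 1 := by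
  unfold shift
  split_ifs
  · simp
  · exact norm_unitVec_le _

lemma norm_shift (p : Tour N) (t : ℕ) {m : Fin N} (hm : p.goal m ≠ p.v p.k) :
    ‖p.shift t m‖ = 1 := by
  unfold shift
  split_ifs
  · simp
  · exact norm_unitVec (sub_ne_zero.2 hm)

/-- The geometric requirements for a formation that draws along a `δ`-drawing path, with
`s` formations in total and a hull `H` at time `0`. -/
structure Valid (p : Tour N) (ε δ : ℝ) (s : ℕ) (H : DrawingHull) : Prop where
  eps_pos : 0 < ε
  one_le_s : 1 ≤ s
  one_le_k : 1 ≤ p.k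
  aligned : IsAligned H s 1
  anchor_eq : H.anchor = p.v 1
  norm_anchor : ‖H.anchor‖ = 2 * H.diam
  diam_le : H.diam ≤ 1 / 6
  diam_le_delta : H.diam ≤ δ
  start_mem : ∀ m, p.start m ∈ H.carrier
  start_grid : ∀ m, p.start m ∈ grid H.anchor ε
  start_inj : Function.Injective p.start
  exists_first : ∃ m, p.start m = H.anchor
  exists_second : ∃ m, p.start m = H.anchor + (ε : ℂ)
  exists_third : ∃ m, ∃ far : ℝ, ε < far ∧ p.start m = H.anchor + (far : ℂ)
  goal_inj : Function.Injective p.goal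
  goal_cone : ∀ (i : Fin s) m, (rotor s (i + 1) : ℂ) * p.goal m ∈ cone s (i + 1)
  closedBall_subset : ∀ j, 1 ≤ j → j ≤ p.k → Metric.closedBall (p.v j) ε ⊆ openCone s
  edge_le : ∀ j, 1 ≤ j → j < p.k → dist (p.v j) (p.v (j + 1)) ≤ 1 - δ
  one_le_level : ∀ m, 1 ≤ p.level m
  level_le : ∀ m, p.level m ≤ p.k
  tail_le : p.tail ≤ p.k
  dist_level : ∀ m, dist (p.goal m) (p.v (p.level m)) ≤ 1 - δ
  lt_dist : ∀ m j, p.level m < j → j ≤ p.k → 1 - δ < dist (p.goal m) (p.v j)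
  dist_tail : ∀ m, p.tail ≤ p.level m → dist (p.goal m) (p.v p.k) ≤ 1
  exists_tail : ∀ m m', ∃ l, p.tail ≤ p.level l ∧ l ≠ m ∧ l ≠ m'
  head_mem : p.tail ≤ p.level p.head
  head_ne : p.goal p.head ≠ p.v p.k
  scale_pos : 0 < p.scale
  scale_le_eps : 20 * p.scale ≤ ε
  scale_le_diam : 20 * p.scale ≤ H.diam
  scale_le_goal : ∀ b b' : Fin s × Fin N,
    (rotor s (b.1 + 1) : ℂ) * p.goal b.2 ≠ (rotor s (b'.1 + 1) : ℂ) * p.goal b'.2 →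
    20 * p.scale ≤ dist ((rotor s (b.1 + 1) : ℂ) * p.goal b.2) ((rotor s (b'.1 + 1) : ℂ) * p.goal b'.2)
  scale_le_path : ∀ m j, 1 ≤ j → j ≤ p.k → p.goal m ≠ p.v j → 20 * p.scale ≤ dist (p.goal m) (p.v j)

/-! ### Separation and step lengths of a tour -/

namespace Valid

variable {p : Tour N} {ε δ : ℝ} {s : ℕ} {H : DrawingHull}

lemma size_pos (V : p.Valid ε δ s H) (t : ℕ) : 0 < p.size t :=
  div_pos V.scale_pos (by positivity)

lemma size_le (V : p.Valid ε δ s H) (t : ℕ) : p.size t ≤ p.scale :=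
  div_le_self V.scale_pos.le (one_le_pow₀ one_le_two)

lemma size_lt (V : p.Valid ε δ s H) {t t' : ℕ} (h : t < t') : 2 * p.size t' ≤ p.size t := by
  obtain ⟨d, rfl⟩ := Nat.exists_eq_add_of_lt h
  have := V.scale_pos
  unfold size
  rw [pow_succ, pow_add, ← div_div, mul_div_cancel₀ _ two_ne_zero]
  refine div_le_div_of_nonneg_left this.le (by positivity) ?_
  exact le_mul_of_one_le_right (by positivity) (one_le_pow₀ one_le_two)

lemma center_mem (V : p.Valid ε δ s H) (t : ℕ) : Metric.closedBall (p.center t) ε ⊆ openCone s :=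
  V.closedBall_subset _ (le_min (by omega) V.one_le_k) (min_le_right _ _)

lemma tau_mem (V : p.Valid ε δ s H) (t : ℕ) (m : Fin N) :
    0 < p.size t * offset p.head m ∧ p.size t * offset p.head m ≤ p.size t :=
  ⟨mul_pos (V.size_pos t) (offset_pos _ _), mul_le_of_le_one_right (V.size_pos t).le (offset_le_one _ _)⟩

lemma dist_center (V : p.Valid ε δ s H) {t : ℕ} (h1 : 1 ≤ t) (hk : t ≤ p.k) {m : Fin N}
    (hm : m ∈ p.act t) :
    dist (p.pos t m) (p.center t) = p.size t * offset p.head m * ‖p.shift t m‖ := by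
  rw [p.pos_act h1 hk hm, dist_eq_norm, add_sub_cancel_left, norm_mul, Complex.norm_real,
    Real.norm_of_nonneg (V.tau_mem t m).1.le]

lemma dist_center_le (V : p.Valid ε δ s H) {t : ℕ} (h1 : 1 ≤ t) (hk : t ≤ p.k) {m : Fin N}
    (hm : m ∈ p.act t) : dist (p.pos t m) (p.center t) ≤ p.size t * offset p.head m := by
  rw [V.dist_center h1 hk hm]
  exact mul_le_of_le_one_right (V.tau_mem t m).1.le (p.norm_shift_le t m)

lemma one_sub_nonneg (V : p.Valid ε δ s H) : 0 ≤ 1 - δ := dist_nonneg.trans (V.dist_level p.head)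

/-- A resting robot has its level below the index of the current vertex. Its goal is therefore out
of reach of that vertex, in particular different from it, and the choice of the scale applies. -/
lemma rest_far (V : p.Valid ε δ s H) {t : ℕ} (hk : t ≤ p.k) {m : Fin N}
    (hm : m ∉ p.act t) : 20 * p.scale ≤ dist (p.goal m) (p.center t) := by
  simp only [act, Set.mem_ofPred_eq, not_or, not_lt, not_le] at hm
  have hle := V.tail_le
  have h1 : p.level m < min (t + 1) p.k := lt_min (by omega) (by omega)
  have h2 := V.lt_dist m _ h1 (min_le_right _ _)
  have h3 := V.one_sub_nonneg
  refine V.scale_le_path m _ (by omega) (min_le_right _ _) ?_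
  intro e
  rw [e, dist_self] at h2
  linarith

lemma place_mem_cone (V : p.Valid ε δ s H) (t : ℕ) (b : Fin s × Fin N) :
    place s p.pos t b ∈ cone s (b.1 + 1) := by
  have hi : (b.1 : ℕ) + 1 ∈ Finset.Icc 1 s := Finset.mem_Icc.2 ⟨by omega, b.1.2⟩
  unfold place
  rcases Nat.eq_zero_or_pos t with rfl | h1
  · rw [p.pos_zero]
    refine rotor_mul_mem_cone_of_openCone hi ?_
    have hb := V.closedBall_subset 1 le_rfl V.one_le_k
    rw [← V.anchor_eq] at hb
    exact V.aligned.closedBall_subset V.one_le_s hb (V.start_mem b.2)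
      (Metric.mem_closedBall_self V.eps_pos.le)
  · by_cases h : t ≤ p.k ∧ b.2 ∈ p.act t
    · refine rotor_mul_mem_cone_of_openCone hi (V.center_mem t ?_)
      rw [Metric.mem_closedBall]
      have e1 := V.dist_center_le h1 h.1 h.2
      have e2 := (V.tau_mem t b.2).2
      have e3 := V.size_le t
      have e4 := V.scale_pos
      have e5 := V.scale_le_eps
      linarith
    · rw [p.pos_rest h1 h]
      exact V.goal_cone b.1 b.2

lemma lt_dist_start (V : p.Valid ε δ s H) {b b' : Fin s × Fin N} (h : b.1 ≠ b'.1) :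
    ε < dist (place s p.pos 0 b) (place s p.pos 0 b') := by
  have hi : (b.1 : ℕ) + 1 ∈ Finset.Icc 1 s := Finset.mem_Icc.2 ⟨by omega, b.1.2⟩
  have hb := V.closedBall_subset 1 le_rfl V.one_le_k
  rw [← V.anchor_eq] at hb
  refine lt_dist_of_mem_cone hi (fun e => h (Fin.ext (by omega))) ?_ (V.place_mem_cone 0 b')
  rw [p.pos_zero]
  exact V.aligned.closedBall_subset V.one_le_s hb (V.start_mem b.2)

/-- Distances to the centre differ because the offsets do. The exception is a robot whose goal is
the last vertex: at time `k` it is at the centre itself, and since goals are distinct there is at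
most one. -/
lemma pos_act_inj (V : p.Valid ε δ s H) {t : ℕ} (h1 : 1 ≤ t) (hk : t ≤ p.k) {m m' : Fin N}
    (hm : m ∈ p.act t) (hm' : m' ∈ p.act t) (h : p.pos t m = p.pos t m') : m = m' := by
  have e1 := V.dist_center h1 hk hm
  have e2 := V.dist_center h1 hk hm'
  rw [h, e2] at e1
  have hpos := V.tau_mem t m
  have hpos' := V.tau_mem t m'
  by_cases hz : p.goal m = p.v p.k <;> by_cases hz' : p.goal m' = p.v p.k
  · exact V.goal_inj (hz.trans hz'.symm)
  · rw [p.norm_shift t hz', mul_one] at e1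
    by_cases hlt : t < p.k
    · rw [shift, if_pos hlt, norm_one, mul_one] at e1
      exact (offset_injective _ (mul_left_cancel₀ (V.size_pos t).ne' e1)).symm
    · rw [shift, if_neg hlt, hz, sub_self, unitVec, mul_zero, norm_zero, mul_zero] at e1
      exact absurd e1 hpos'.1.ne'
  · rw [p.norm_shift t hz, mul_one] at e1
    by_cases hlt : t < p.k
    · rw [shift, if_pos hlt, norm_one, mul_one] at e1
      exact (offset_injective _ (mul_left_cancel₀ (V.size_pos t).ne' e1)).symm
    · rw [shift, if_neg hlt, hz', sub_self, unitVec, mul_zero, norm_zero, mul_zero] at e1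
      exact absurd e1.symm hpos.1.ne'
  · rw [p.norm_shift t hz, p.norm_shift t hz', mul_one, mul_one] at e1
    exact (offset_injective _ (mul_left_cancel₀ (V.size_pos t).ne' e1)).symm

lemma goal_rotor_inj (V : p.Valid ε δ s H) {b b' : Fin s × Fin N}
    (h : (rotor s (b.1 + 1) : ℂ) * p.goal b.2 = (rotor s (b'.1 + 1) : ℂ) * p.goal b'.2) :
    b = b' := by
  have hi : (b.1 : ℕ) + 1 ∈ Finset.Icc 1 s := Finset.mem_Icc.2 ⟨by omega, b.1.2⟩
  have h1 := cone_index_unique hi (V.goal_cone b.1 b.2) (h ▸ V.goal_cone b'.1 b'.2)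
  have h2 : b.1 = b'.1 := Fin.ext (by omega)
  rw [h2] at h
  exact Prod.ext h2 (V.goal_inj (mul_left_cancel₀ (rotor_ne_zero _ _) h))

/-- Within a formation, resting robots are far from the centre of the cluster. Robots of other
formations lie in other cones, more than ε from the centre. -/
lemma separated_of_act (V : p.Valid ε δ s H) {t : ℕ} (h1 : 1 ≤ t) (hk : t ≤ p.k)
    {b b' : Fin s × Fin N} (hb : b.2 ∈ p.act t) (hnot : ¬ (b.1 = b'.1 ∧ b'.2 ∈ p.act t)) :
    4 * p.scale ≤ dist (place s p.pos t b) (place s p.pos t b') := by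
  have hi : (b.1 : ℕ) + 1 ∈ Finset.Icc 1 s := Finset.mem_Icc.2 ⟨by omega, b.1.2⟩
  have e1 := V.dist_center_le h1 hk hb
  have e2 := (V.tau_mem t b.2).2
  have e3 := V.size_le t
  have e4 := V.scale_pos
  by_cases h : b.1 = b'.1
  · have hb' : b'.2 ∉ p.act t := fun h' => hnot ⟨h, h'⟩
    have e5 := V.rest_far hk hb'
    have e6 := dist_triangle_left (p.goal b'.2) (p.center t) (p.pos t b.2)
    unfold place
    rw [← h, dist_circle_mul, p.pos_rest h1 (fun h' => hb' h'.2)]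
    linarith
  · have e5 := lt_dist_of_mem_cone hi (fun e => h (Fin.ext (by omega))) (V.center_mem t)
      (V.place_mem_cone t b')
    have e6 := dist_triangle_left ((rotor s (b.1 + 1) : ℂ) * p.center t) (place s p.pos t b')
      (place s p.pos t b)
    have e7 : dist (place s p.pos t b) ((rotor s (b.1 + 1) : ℂ) * p.center t) =
      dist (p.pos t b.2) (p.center t) := dist_circle_mul _ _ _
    have e8 := V.scale_le_eps
    linarith

lemma separated (V : p.Valid ε δ s H) {t : ℕ} (h1 : 1 ≤ t) (hk : t ≤ p.k) {b b' : Fin s × Fin N}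
    (hne : b ≠ b') (hnot : ¬ (b.1 = b'.1 ∧ b.2 ∈ p.act t ∧ b'.2 ∈ p.act t)) :
    4 * p.scale ≤ dist (place s p.pos t b) (place s p.pos t b') := by
  by_cases hb : b.2 ∈ p.act t
  · exact V.separated_of_act h1 hk hb fun h => hnot ⟨h.1, hb, h.2⟩
  by_cases hb' : b'.2 ∈ p.act t
  · rw [dist_comm]
    exact V.separated_of_act h1 hk hb' fun h => hnot ⟨h.1.symm, h.2, hb'⟩
  · have := V.scale_le_goal b b' fun h => hne (V.goal_rotor_inj h)
    unfold place
    rw [p.pos_rest h1 (fun h => hb h.2), p.pos_rest h1 (fun h => hb' h.2)]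
    linarith [V.scale_pos]

lemma place_injective (V : p.Valid ε δ s H) {t : ℕ} (hk : t ≤ p.k) :
    Function.Injective (place s p.pos t) := by
  intro b b' h
  rcases Nat.eq_zero_or_pos t with rfl | h1
  · have hi : b.1 = b'.1 := by
      by_contra hne
      have := V.lt_dist_start hne
      rw [h, dist_self] at this
      exact absurd V.eps_pos (not_lt.2 this.le)
    unfold place at h
    rw [hi, p.pos_zero] at h
    exact Prod.ext hi (V.start_inj (mul_left_cancel₀ (rotor_ne_zero _ _) h))
  · by_contra hne
    by_cases hnot : b.1 = b'.1 ∧ b.2 ∈ p.act t ∧ b'.2 ∈ p.act t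
    · unfold place at h
      rw [hnot.1] at h
      exact hne (Prod.ext hnot.1 (V.pos_act_inj h1 hk hnot.2.1 hnot.2.2
        (mul_left_cancel₀ (rotor_ne_zero _ _) h)))
    · have := V.separated h1 hk hne hnot
      rw [h, dist_self] at this
      linarith [V.scale_pos]

lemma start_dist (V : p.Valid ε δ s H) {b b' : Fin s × Fin N} (hne : b ≠ b') :
    ε ≤ dist (place s p.pos 0 b) (place s p.pos 0 b') ∧
    (dist (place s p.pos 0 b) (place s p.pos 0 b') = ε → b.1 = b'.1 ∧
      ((p.start b.2 = H.anchor ∧ p.start b'.2 = H.anchor + ε) ∨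
       (p.start b.2 = H.anchor + ε ∧ p.start b'.2 = H.anchor))) := by
  by_cases h : b.1 = b'.1
  · have hm : p.start b.2 ≠ p.start b'.2 := fun e => hne (Prod.ext h (V.start_inj e))
    have := grid_dist V.eps_pos (V.start_grid b.2) (V.start_grid b'.2) hm
    unfold place
    rw [h, dist_circle_mul, p.pos_zero]
    exact ⟨this.1, fun e => ⟨rfl, this.2 e⟩⟩
  · have := V.lt_dist_start h
    exact ⟨this.le, fun e => absurd e this.ne'⟩

/-- The anchor has norm 2Δ and hull points add at most Δ, where 3Δ ≤ 1/2. Hence all robots see each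
other at the start. -/
lemma norm_start_le (V : p.Valid ε δ s H) (b : Fin s × Fin N) :
    ‖place s p.pos 0 b‖ ≤ 1 / 2 := by
  unfold place
  rw [norm_mul, Circle.norm_coe, one_mul, p.pos_zero]
  have h1 := (V.start_mem b.2).1
  rw [dist_eq_norm] at h1
  have h2 := V.norm_anchor
  have h3 := norm_le_norm_add_norm_sub' (p.start b.2) H.anchor
  have h4 := V.diam_le
  linarith

/-- A valid tour is a choreography. -/
noncomputable def choreography (V : p.Valid ε δ s H) : Choreography ε s N p.k p.pos where
  anchor := H.anchor
  first := V.exists_first.choose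
  second := V.exists_second.choose
  third := V.exists_third.choose
  far := V.exists_third.choose_spec.choose
  act := p.act
  head := p.head
  center := p.center
  size := p.size
  maxSize := p.scale
  inj _ hk := V.place_injective hk
  eps_pos := V.eps_pos
  visible b b' := by
    rw [dist_eq_norm]
    have h1 := V.norm_start_le b
    have h2 := V.norm_start_le b'
    have h3 := norm_sub_le (place s p.pos 0 b) (place s p.pos 0 b')
    linarith
  sep b b' hne := (V.start_dist hne).1
  eps_pair b b' h := by
    have hne : b ≠ b' := by
      rintro rfl
      rw [dist_self] at h
      exact V.eps_pos.ne h
    obtain ⟨hi, hor⟩ := (V.start_dist hne).2 h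
    have h1 := V.exists_first.choose_spec
    have h2 := V.exists_second.choose_spec
    refine ⟨hi, hor.imp (fun e => ⟨?_, ?_⟩) (fun e => ⟨?_, ?_⟩)⟩
    · exact V.start_inj (e.1.trans h1.symm)
    · exact V.start_inj (e.2.trans h2.symm)
    · exact V.start_inj (e.1.trans h2.symm)
    · exact V.start_inj (e.2.trans h1.symm)
  first_eq := by rw [p.pos_zero]; exact V.exists_first.choose_spec
  second_eq := by rw [p.pos_zero]; exact V.exists_second.choose_spec
  third_eq := by rw [p.pos_zero]; exact V.exists_third.choose_spec.choose_spec.2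
  lt_far := V.exists_third.choose_spec.choose_spec.1
  anchor_re_le m := by rw [p.pos_zero]; exact re_le_of_mem_grid V.eps_pos (V.start_grid m)
  anchor_im_pos hs := by
    have hb := V.closedBall_subset 1 le_rfl V.one_le_k
    rw [← V.anchor_eq] at hb
    rcases hb (Metric.mem_closedBall_self V.eps_pos.le) with h | h
    · omega
    · exact h.1
  rest t h1 hk m hm := by
    rw [p.pos_rest h1 (fun h => hm h.2), p.pos_rest (by omega)]
    exact fun h => hm (p.act_anti (Nat.le_succ t) h.2)
  rest_end t hk := by
    funext m
    rw [p.pos_rest (by omega) (by omega), p.pos_rest (by omega) (by omega)]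
  head_mem t _ _ := Or.inr V.head_mem
  dist_head t h1 hk := by
    rw [V.dist_center h1 hk (Or.inr V.head_mem), p.norm_shift t V.head_ne, offset_head, mul_one,
      mul_one]
  dist_le t h1 hk m hm hne := by
    have := V.dist_center_le h1 hk hm
    have h2 := mul_le_mul_of_nonneg_left (offset_le hne) (V.size_pos t).le
    linarith
  exists_act t _ _ m m' := by
    obtain ⟨l, hl, h⟩ := V.exists_tail m m'
    exact ⟨l, Or.inr hl, h⟩
  size_pos := V.size_pos
  size_le := V.size_le
  size_lt _ _ h := V.size_lt h
  separated t h1 hk b b' hne hnot := V.separated h1 hk hne hnot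
  maxSize_le := by have := V.scale_le_eps; have := V.scale_pos; linarith
  maxSize_le_one := by
    have := V.scale_le_diam; have := V.scale_pos; have := V.diam_le; linarith

/-- Until time `k - 1` the robots that are not dropped are in the hull. -/
lemma pos_mem_hull (V : p.Valid ε δ s H) {t : ℕ} (hk : t < p.k) {m : Fin N} (hm : m ∈ p.act t) :
    p.pos t m ∈ (H.moveTo (p.v (t + 1))).carrier := by
  rcases Nat.eq_zero_or_pos t with rfl | h1
  · rw [p.pos_zero, zero_add, ← V.anchor_eq]
    exact V.start_mem m
  · rw [p.pos_act h1 hk.le hm, shift, if_pos hk, mul_one, center, min_eq_left (by omega)]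
    have h := V.tau_mem t m
    have h2 := V.size_le t
    have h3 := V.scale_le_diam
    have h4 := V.scale_pos
    exact ofReal_add_mem_moveTo V.aligned.dir_eq _ h.1.le (by linarith)

lemma step_le (V : p.Valid ε δ s H) {t : ℕ} (hk : t ≤ p.k) (m : Fin N) :
    ‖p.pos (t + 1) m - p.pos t m‖ ≤ 1 := by
  have hδ := V.diam_le_delta
  have hΔ := V.diam_le
  have hη := V.scale_le_diam
  have hη0 := V.scale_pos
  have hs := V.size_le t
  have hs' := V.size_le (t + 1)
  rw [← dist_eq_norm]
  by_cases hm : m ∈ p.act t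
  swap
  · have h1 : 1 ≤ t := by
      by_contra h
      have : t = 0 := by omega
      exact hm (Or.inl (by have := V.one_le_level m; omega))
    rw [p.pos_rest h1 (fun h => hm h.2), p.pos_rest (by omega)
      (fun h => hm (p.act_anti (Nat.le_succ t) h.2)), dist_self]
    exact zero_le_one
  rcases hk.lt_or_eq with hk | hk
  · have hmem := V.pos_mem_hull hk hm
    have hd : dist (p.pos t m) (p.v (t + 1)) ≤ H.diam := hmem.1
    by_cases hm' : m ∈ p.act (t + 1)
    · have hτ := V.tau_mem (t + 1) m
      rw [p.pos_act (by omega) hk hm', shift, center]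
      rcases Nat.lt_or_ge (t + 1) p.k with hk' | hk'
      · -- both positions are in the hulls at adjacent vertices
        rw [if_pos hk', mul_one, min_eq_left (by omega)]
        have e1 := dist_ofReal_add_le V.aligned.dir_eq hmem hτ.1.le (by linarith)
        have e2 := V.edge_le (t + 1) (by omega) hk'
        rw [dist_eq_norm] at e1 e2 ⊢
        have e3 := norm_sub_le (p.v (t + 1) - p.v (t + 1 + 1))
          (((p.size (t + 1) * offset p.head m : ℝ) : ℂ) - (p.pos t m - p.v (t + 1)))
        rw [norm_sub_rev] at e1
        have e4 : p.v (t + 1 + 1) + ((p.size (t + 1) * offset p.head m : ℝ) : ℂ) - p.pos t m =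
          -(p.v (t + 1) - p.v (t + 1 + 1) -
            (((p.size (t + 1) * offset p.head m : ℝ) : ℂ) - (p.pos t m - p.v (t + 1)))) := by ring
        rw [e4, norm_neg]
        linarith
      · have hkt : p.k = t + 1 := by omega
        rw [if_neg (by omega), min_eq_right (by omega), hkt]
        have e1 : dist (p.v (t + 1) + ((p.size (t + 1) * offset p.head m : ℝ) : ℂ) *
            unitVec (p.goal m - p.v (t + 1))) (p.v (t + 1)) ≤ p.size (t + 1) := by
          rw [dist_eq_norm, add_sub_cancel_left, norm_mul, Complex.norm_real,
            Real.norm_of_nonneg hτ.1.le]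
          exact (mul_le_of_le_one_right hτ.1.le (norm_unitVec_le _)).trans hτ.2
        refine (dist_triangle_right _ _ (p.v (t + 1))).trans ?_
        linarith
    · rw [p.pos_rest (by omega) (fun h => hm' h.2)]
      -- The robot is dropped just now, so its goal is within 1 - δ of the vertex that it leaves.
      have hl : p.level m = t + 1 := by
        simp only [act, Set.mem_ofPred_eq, not_or] at hm hm'
        omega
      have e1 := V.dist_level m
      rw [hl] at e1
      refine (dist_triangle_right _ _ (p.v (t + 1))).trans ?_
      linarith
  · have h1 := V.one_le_k
    have htail : p.tail ≤ p.level m := by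
      have := V.level_le m
      rcases hm with h | h <;> omega
    rw [p.pos_rest (by omega) (by omega), p.pos_act (by omega) hk.le hm, shift, center,
      if_neg (by omega), min_eq_right (by omega), dist_eq_norm, ← sub_sub]
    have hτ := V.tau_mem t m
    refine norm_sub_mul_unitVec_le ?_ hτ.1.le (by linarith)
    rw [← dist_eq_norm]
    exact V.dist_tail m htail

end Valid
end Tour

/-! ### Initial drawing patterns -/

lemma hull_subset_cone {H : DrawingHull} {s i : ℕ} (hi : i ∈ Finset.Icc 1 s) (h : IsAligned H s 1)
    {q : ℂ} {ε : ℝ} (hε : 0 ≤ ε) (hq : Metric.closedBall q ε ⊆ openCone s) :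
    ((formationHull H s i).moveTo ((rotor s i : ℂ) * q)).carrier ⊆ cone s i := by
  intro z hz
  have hs : 1 ≤ s := (Finset.mem_Icc.1 hi).1.trans (Finset.mem_Icc.1 hi).2
  have hz' : (rotor s i : ℂ) * ((rotor s i : ℂ)⁻¹ * z) = z :=
    mul_inv_cancel_left₀ (rotor_ne_zero s i) z
  rw [← hz'] at hz ⊢
  rw [rotor_mul_mem_moveTo] at hz
  exact rotor_mul_mem_cone_of_openCone hi
    (h.closedBall_subset hs hq hz (Metric.mem_closedBall_self hε))

namespace IsInitialDrawingPattern

variable {ε : ℝ} {e : StateEnum ε} {P : Finset ℂ} {s : ℕ} {H : DrawingHull} {R : Fin P.card → ℂ}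

lemma state_mem (h : IsInitialDrawingPattern e P s H R) {i : ℕ} (hi : i ∈ Finset.Icc 1 s) :
    (formationHull H s i).state R ∈ (formationHull H s i).granularStatesOfSize ε
      ((formationHull H s i).robots R).ncard := by
  obtain ⟨h1, h2⟩ := h.state_one i hi
  rw [h2]
  exact (e.bijOn _ _).mapsTo h1

/-- The state of a formation has as many points as the formation has robots, so no two robots share
a position. -/
lemma injective (h : IsInitialDrawingPattern e P s H R) : Function.Injective R := by
  intro r r' hrr
  obtain ⟨i, hi, hr⟩ := h.mem_formation r
  have hr' : r' ∈ (formationHull H s i).robots R := by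
    simp only [DrawingHull.robots, Set.mem_ofPred_eq] at hr ⊢
    rwa [← hrr]
  exact Set.injOn_of_ncard_image_eq (h.state_mem hi).2 (Set.toFinite _) hr hr' hrr

lemma state_first_mem (h : IsInitialDrawingPattern e P s H R) (hs : 1 ≤ s) :
    H.state R ∈ H.granularStatesOfSize ε (H.robots R).ncard := by
  have := h.state_mem (Finset.mem_Icc.2 ⟨le_rfl, hs⟩)
  rwa [formationHull_one] at this

lemma state_first_eq (h : IsInitialDrawingPattern e P s H R) (hs : 1 ≤ s) :
    H.state R = e.nth H (H.robots R).ncard 1 := by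
  have := (h.state_one 1 (Finset.mem_Icc.2 ⟨le_rfl, hs⟩)).2
  rwa [formationHull_one] at this

/-- The robots are labelled by their formation and their place in it. -/
lemma exists_labelling (h : IsInitialDrawingPattern e P s H R)
    {L : ℕ} {x : ℕ → Fin L → ℂ} (hx : Function.Injective (x 0)) (hrange : Set.range (x 0) = H.state R)
    (hball : Metric.closedBall H.anchor 0 ⊆ openCone s) :
    ∃ φ : Fin P.card → Fin s × Fin L, Function.Bijective φ ∧ R = place s x 0 ∘ φ ∧
      ∀ r (i : Fin s), r ∈ (formationHull H s (i + 1)).robots R ↔ (φ r).1 = i := by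
  have hIcc : ∀ i : Fin s, (i : ℕ) + 1 ∈ Finset.Icc 1 s := fun i =>
    Finset.mem_Icc.2 ⟨by omega, i.2⟩
  have hmem : ∀ m, x 0 m ∈ H.carrier := by
    intro m
    obtain ⟨r, hr, he⟩ : x 0 m ∈ H.state R := hrange ▸ Set.mem_range_self m
    rw [← he]
    exact hr
  have hhull : ∀ b : Fin s × Fin L, place s x 0 b ∈ (formationHull H s (b.1 + 1)).carrier :=
    fun b => carrier_formationHull.2 (hmem b.2)
  have hcone : ∀ i : Fin s, (formationHull H s (i + 1)).carrier ⊆ cone s (i + 1) := by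
    intro i
    have := hull_subset_cone (hIcc i) h.aligned le_rfl hball
    rwa [← formationHull_anchor] at this
  have hinj : Function.Injective (place s x 0) := by
    intro b b' hb
    have h1 := hcone _ (hhull b)
    have h2 := hcone _ (hhull b')
    rw [hb] at h1
    have h3 : b.1 = b'.1 := Fin.ext (by have := cone_index_unique (hIcc _) h1 h2; omega)
    unfold place at hb
    rw [h3] at hb
    exact Prod.ext h3 (hx (mul_left_cancel₀ (rotor_ne_zero _ _) hb))
  have hstate : ∀ i : Fin s, (formationHull H s (i + 1)).state R =
      (fun z => (rotor s (i + 1) : ℂ) * z) '' Set.range (x 0) := fun i => by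
    rw [h.rotated _ (hIcc i), hrange]
  have hex : ∀ r, ∃ b, R r = place s x 0 b := by
    intro r
    obtain ⟨i, hi, hr⟩ := h.mem_formation r
    obtain ⟨h1, h2⟩ := Finset.mem_Icc.1 hi
    obtain ⟨i, rfl⟩ : ∃ j : Fin s, i = j + 1 := ⟨⟨i - 1, by omega⟩, by simp; omega⟩
    obtain ⟨_, ⟨m, rfl⟩, hm⟩ : R r ∈ (fun z => (rotor s (i + 1) : ℂ) * z) '' Set.range (x 0) := by
      rw [← hstate]
      exact ⟨r, hr, rfl⟩
    exact ⟨(i, m), hm.symm⟩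
  choose φ hφ using hex
  refine ⟨φ, ⟨?_, ?_⟩, funext hφ, ?_⟩
  · intro r r' hr
    apply h.injective
    rw [hφ, hφ, hr]
  · rintro ⟨i, m⟩
    obtain ⟨r, -, hr⟩ : place s x 0 (i, m) ∈ (formationHull H s (i + 1)).state R := by
      rw [hstate]
      exact ⟨_, ⟨m, rfl⟩, rfl⟩
    exact ⟨r, hinj (by rw [← hφ, hr])⟩
  · intro r i
    simp only [DrawingHull.robots, Set.mem_ofPred_eq]
    constructor
    · intro hr
      have h1 := hcone _ hr
      have h2 := hcone _ (hhull (φ r))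
      rw [← hφ] at h2
      have := cone_index_unique (hIcc _) h2 h1
      exact Fin.ext (by omega)
    · intro hr
      rw [hφ, ← hr]
      exact hhull _

/-- This determines the formation size from `P` and `s` alone, and with it the state that has number
1. -/
lemma card_eq (h : IsInitialDrawingPattern e P s H R) (hs : 1 ≤ s)
    (hball : Metric.closedBall H.anchor 0 ⊆ openCone s) : P.card = s * (H.robots R).ncard := by
  have hfin : (H.state R).Finite := (Set.toFinite _).image _
  have hc := (h.state_first_mem hs).2
  have := hfin.to_subtype
  let x : Fin (H.state R).ncard ≃ H.state R :=
    (Finite.equivFinOfCardEq (Nat.card_coe_set_eq _ ) : H.state R ≃ _).symm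
  obtain ⟨φ, hφ, -⟩ := h.exists_labelling (x := fun _ m => (x m : ℂ))
    (Subtype.val_injective.comp x.injective)
    (by rw [Set.range_comp' , x.surjective.range_eq, Set.image_univ, Subtype.range_coe]) hball
  have := Fintype.card_of_bijective hφ
  simpa [hc] using this

end IsInitialDrawingPattern

/-! ### Covered points -/

lemma cov_rotor (δ : ℝ) (Q : Set ℂ) (k : ℕ) (v : ℕ → ℂ) (w : Circle) (j : ℕ) :
    cov δ ((fun z => (w : ℂ) * z) '' Q) k (fun j => (w : ℂ) * v j) j =
      (fun z => (w : ℂ) * z) '' cov δ Q k v j := by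
  ext z
  constructor
  · rintro ⟨⟨z, hz, rfl⟩, h1, h2⟩
    simp only [dist_circle_mul] at h1 h2
    exact ⟨z, ⟨hz, h1, h2⟩, rfl⟩
  · rintro ⟨z, ⟨hz, h1, h2⟩, rfl⟩
    refine ⟨⟨z, hz, rfl⟩, ?_⟩
    simp only [dist_circle_mul]
    exact ⟨h1, h2⟩

lemma tailStart_rotor (δ : ℝ) (Q : Set ℂ) (k : ℕ) (v : ℕ → ℂ) (w : Circle) :
    tailStart δ ((fun z => (w : ℂ) * z) '' Q) k (fun j => (w : ℂ) * v j) = tailStart δ Q k v := by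
  unfold tailStart
  simp only [cov_rotor]
  congr! 6
  exact Set.ncard_image_of_injective _ (mul_right_injective₀ (Circle.coe_ne_zero w))

lemma covTail_rotor (δ : ℝ) (Q : Set ℂ) (k : ℕ) (v : ℕ → ℂ) (w : Circle) :
    covTail δ ((fun z => (w : ℂ) * z) '' Q) k (fun j => (w : ℂ) * v j) =
      (fun z => (w : ℂ) * z) '' covTail δ Q k v := by
  unfold covTail
  rw [tailStart_rotor, Set.image_iUnion₂]
  simp only [cov_rotor]

lemma exists_mem_cov {δ : ℝ} {Q : Set ℂ} {k : ℕ} {v : ℕ → ℂ} (h : IsDrawingPath δ Q k v) {p : ℂ}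
    (hp : p ∈ Q) : ∃ j ∈ Finset.Icc 1 k, p ∈ cov δ Q k v j := by
  classical
  obtain ⟨j, hj, hd⟩ := h.1 p hp
  obtain ⟨l, hl, hmax⟩ := ((Finset.Icc 1 k).filter fun j => dist p (v j) ≤ 1 - δ).exists_max_image id
    ⟨j, Finset.mem_filter.2 ⟨hj, hd⟩⟩
  obtain ⟨hl1, hl2⟩ := Finset.mem_filter.1 hl
  refine ⟨l, hl1, hp, hl2, fun j' h1 h2 => ?_⟩
  by_contra hcon
  have := hmax j' (Finset.mem_filter.2 ⟨Finset.mem_Icc.2 ⟨by omega, h2⟩, not_lt.1 hcon⟩)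
  simp only [id] at this
  omega

lemma cov_index_unique {δ : ℝ} {Q : Set ℂ} {k : ℕ} {v : ℕ → ℂ} {p : ℂ} {j j' : ℕ} (hj : j ≤ k)
    (hj' : j' ≤ k) (h : p ∈ cov δ Q k v j) (h' : p ∈ cov δ Q k v j') : j = j' := by
  rcases lt_trichotomy j j' with hlt | heq | hlt
  · exact absurd h'.2.1 (not_le.2 (h.2.2 _ hlt hj'))
  · exact heq
  · exact absurd h.2.1 (not_le.2 (h'.2.2 _ hlt hj))

lemma mem_covTail_iff {δ : ℝ} {Q : Set ℂ} {k : ℕ} {v : ℕ → ℂ} {p : ℂ} {j : ℕ} (hj : j ≤ k)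
    (h : p ∈ cov δ Q k v j) : p ∈ covTail δ Q k v ↔ tailStart δ Q k v ≤ j := by
  simp only [covTail, Set.mem_iUnion, Finset.mem_Icc, exists_prop]
  constructor
  · rintro ⟨j', ⟨h1, h2⟩, h3⟩
    rwa [cov_index_unique hj h2 h h3]
  · intro h1
    exact ⟨j, ⟨h1, hj⟩, h⟩


/-! ### Drawing the pattern -/

lemma exists_enum {S : Set ℂ} (hS : S.Finite) {N : ℕ} (hN : S.ncard = N) :
    ∃ f : Fin N → ℂ, Function.Injective f ∧ Set.range f = S := by
  have := hS.to_subtype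
  let x : Fin N ≃ S := (Finite.equivFinOfCardEq ((Nat.card_coe_set_eq _).trans hN) : S ≃ _).symm
  exact ⟨fun m => x m, Subtype.val_injective.comp x.injective,
    by rw [Set.range_comp', x.surjective.range_eq, Set.image_univ, Subtype.range_coe]⟩

lemma IsSymmetricity.hasRegularPartition {P : Set ℂ} {s : ℕ} (hP : P.Nonempty)
    (h0 : IsEnclosingCenter P 0) (h : IsSymmetricity P s) : HasRegularPartition P 0 s := by
  obtain ⟨c, hc, hs, -⟩ := h
  rwa [← IsEnclosingCenter.unique hP h0 hc] at hs

lemma component_one_ncard {P : Finset ℂ} {s : ℕ} (hP : HasRegularPartition (P : Set ℂ) 0 s) :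
    P.card = s * (component (P : Set ℂ) s 1).ncard := by
  classical
  obtain ⟨N, hN⟩ : ∃ N, (component (P : Set ℂ) s 1).ncard = N := ⟨_, rfl⟩
  obtain ⟨g, hg, hrange⟩ := exists_enum (S := component (P : Set ℂ) s 1)
    (P.finite_toSet.subset Set.inter_subset_left) hN
  have hIcc : ∀ i : Fin s, (i : ℕ) + 1 ∈ Finset.Icc 1 s := fun i =>
    Finset.mem_Icc.2 ⟨by omega, i.2⟩
  let f : Fin s × Fin N → ℂ :=
    fun b => (rotor s (b.1 + 1) : ℂ) * g b.2
  have hmem : ∀ b, f b ∈ component (P : Set ℂ) s (b.1 + 1) := fun b => by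
    rw [component_eq_image hP (hIcc b.1), ← hrange]
    exact ⟨_, ⟨b.2, rfl⟩, rfl⟩
  have hinj : Function.Injective f := by
    intro b b' hb
    have h1 := cone_index_unique (hIcc b.1) (hmem b).2 (hb ▸ (hmem b').2)
    have h2 : b.1 = b'.1 := Fin.ext (by omega)
    simp only [f, h2] at hb
    exact Prod.ext h2 (hg (mul_left_cancel₀ (rotor_ne_zero _ _) hb))
  have himg : Finset.univ.image f = P := by
    ext z
    rw [Finset.mem_image]
    constructor
    · rintro ⟨b, -, rfl⟩
      exact (hmem b).1
    · intro hz
      obtain ⟨i, hi, hzi⟩ := exists_mem_cone hP.1 z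
      have hzc : z ∈ component (P : Set ℂ) s i := ⟨hz, hzi⟩
      rw [component_eq_image hP hi, ← hrange] at hzc
      obtain ⟨_, ⟨m, rfl⟩, hm⟩ := hzc
      obtain ⟨h1, h2⟩ := Finset.mem_Icc.1 hi
      refine ⟨(⟨i - 1, by omega⟩, m), Finset.mem_univ _, ?_⟩
      simp only [f, Nat.sub_add_cancel h1]
      exact hm
  rw [hN, ← himg, Finset.card_image_of_injective _ hinj, Finset.card_univ, Fintype.card_prod,
    Fintype.card_fin, Fintype.card_fin]

/-- The tour of the first formation, for the given path and any initial drawing pattern. -/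
lemma exists_tour {P : Finset ℂ} {s : ℕ} (hP : HasRegularPartition (P : Set ℂ) 0 s)
    {ε : ℝ} (hε : 0 < ε) {e : StateEnum ε} {H : DrawingHull} {δ : ℝ} {k : ℕ} {v : ℕ → ℂ}
    (hpath : IsDrawingPath δ (component P s 1) k v)
    (hcomp : Compatible ε H δ (component P s 1) k v) (hv1 : v 1 = H.anchor) (hk : 1 ≤ k)
    (hball : ∀ j, 1 ≤ j → j ≤ k → Metric.closedBall (v j) ε ⊆ openCone s)
    {R₀ : Fin P.card → ℂ} (hR₀ : IsInitialDrawingPattern e P s H R₀) :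
    ∃ (N : ℕ) (p : Tour N), p.Valid ε δ s H ∧ p.v = v ∧ p.k = k ∧
      p.tail = tailStart δ (component P s 1) k v ∧
      Set.range p.goal = component P s 1 ∧
      (∀ m, p.goal m ∈ cov δ (component P s 1) k v (p.level m)) ∧
      ∀ R : Fin P.card → ℂ, IsInitialDrawingPattern e P s H R → Set.range p.start = H.state R := by
  have hs := hP.1
  set Q := component (P : Set ℂ) s 1 with hQ
  have hQfin : Q.Finite := P.finite_toSet.subset Set.inter_subset_left
  have hballa : Metric.closedBall H.anchor ε ⊆ openCone s := hv1 ▸ hball 1 le_rfl hk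
  have hball0 : Metric.closedBall H.anchor 0 ⊆ openCone s :=
    (Metric.closedBall_subset_closedBall hε.le).trans hballa
  have hL : ∀ R : Fin P.card → ℂ, IsInitialDrawingPattern e P s H R →
      (H.robots R).ncard = Q.ncard := by
    intro R hR
    have h1 := hR.card_eq hs hball0
    exact Nat.eq_of_mul_eq_mul_left hs (h1.symm.trans (component_one_ncard hP))
  have hstate : ∀ R : Fin P.card → ℂ, IsInitialDrawingPattern e P s H R →
      H.state R = e.nth H Q.ncard 1 := fun R hR => by rw [hR.state_first_eq hs, hL R hR]
  have hmem := hR₀.state_first_mem hs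
  rw [hL R₀ hR₀] at hmem
  obtain ⟨start, hstart, hsrange⟩ := exists_enum (S := H.state R₀) ((Set.toFinite _).image _) hmem.2
  obtain ⟨goal, hgoal, hgrange⟩ := exists_enum hQfin rfl
  have hgQ : ∀ m, goal m ∈ Q := fun m => hgrange ▸ Set.mem_range_self m
  choose level hlevel using fun m => exists_mem_cov hpath (hgQ m)
  have hl1 : ∀ m, 1 ≤ level m := fun m => (Finset.mem_Icc.1 (hlevel m).1).1
  have hlk : ∀ m, level m ≤ k := fun m => (Finset.mem_Icc.1 (hlevel m).1).2
  have htail : ∀ m, goal m ∈ covTail δ Q k v ↔ tailStart δ Q k v ≤ level m :=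
    fun m => mem_covTail_iff (hlk m) (hlevel m).2
  have hcovTail : covTail δ Q k v = goal '' {m | tailStart δ Q k v ≤ level m} := by
    ext z
    constructor
    · intro hz
      have hzQ : z ∈ Q := by
        simp only [covTail, Set.mem_iUnion] at hz
        obtain ⟨_, _, h, _⟩ := hz
        exact h
      rw [← hgrange] at hzQ
      obtain ⟨m, rfl⟩ := hzQ
      exact ⟨m, (htail m).1 hz, rfl⟩
    · rintro ⟨m, hm, rfl⟩
      exact (htail m).2 hm
  have hthree : {m | tailStart δ Q k v ≤ level m}.ncard = 3 := by
    rw [← Set.ncard_image_of_injective _ hgoal, ← hcovTail, hcomp.covTail_card]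
  have hexT : ∀ m m', ∃ l, tailStart δ Q k v ≤ level l ∧ l ≠ m ∧ l ≠ m' := by
    intro m m'
    obtain ⟨l, hl, hl'⟩ := Set.exists_mem_notMem_of_ncard_lt_ncard
      (s := {m, m'}) (t := {m | tailStart δ Q k v ≤ level m})
      (by rw [hthree]; exact (Set.ncard_insert_le _ _).trans_lt (by rw [Set.ncard_singleton]; norm_num))
    simp only [Set.mem_insert_iff, Set.mem_singleton_iff, not_or] at hl'
    exact ⟨l, hl, hl'⟩
  obtain ⟨l₀, hl₀⟩ : {m | tailStart δ Q k v ≤ level m}.Nonempty := by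
    rw [← Set.ncard_pos (Set.toFinite _), hthree]; norm_num
  -- The tail has three robots and at most one of them has the last vertex as its goal. The head
  -- must be another one, since it needs a direction at time `k`.
  obtain ⟨head, hhead, hheadne⟩ : ∃ l, tailStart δ Q k v ≤ level l ∧ goal l ≠ v k := by
    by_cases h : goal l₀ = v k
    · obtain ⟨l, hl, hne, -⟩ := hexT l₀ l₀
      exact ⟨l, hl, fun h' => hne (hgoal (h'.trans h.symm))⟩
    · exact ⟨l₀, hl₀, h⟩
  obtain ⟨η₁, hη₁, hmin₁⟩ := exists_pos_le fun b : (Fin s × Fin Q.ncard) × (Fin s × Fin Q.ncard) =>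
    dist ((rotor s (b.1.1 + 1) : ℂ) * goal b.1.2) ((rotor s (b.2.1 + 1) : ℂ) * goal b.2.2)
  obtain ⟨η₂, hη₂, hmin₂⟩ := exists_pos_le fun b : Fin Q.ncard × Fin (k + 1) =>
    dist (goal b.1) (v b.2)
  -- Clusters are to be small against every positive distance among all goals and between goals and
  -- path vertices, and against ε and Δ. The divisor 20 leaves room for the triangle inequalities.
  set μ := min (min η₁ η₂) (min ε H.diam) with hμ
  have hμpos : 0 < μ := lt_min (lt_min hη₁ hη₂) (lt_min hε H.diam_mem.1)
  have hμ20 : 20 * (μ / 20) = μ := by ring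
  obtain ⟨hgrid, hfst, hsnd, far, hfar, hthd⟩ :=
    granularStates_subset_grid hR₀.aligned.dir_eq hε hmem.1
  rw [← hsrange] at hfst hsnd hthd
  have hsmem : ∀ m, start m ∈ H.state R₀ := fun m => hsrange ▸ Set.mem_range_self m
  refine ⟨_, ⟨start, goal, v, k, level, tailStart δ Q k v, head, μ / 20⟩, ?_, rfl, rfl, rfl,
    hgrange, fun m => (hlevel m).2, fun R hR => by rw [hstate R hR, ← hstate R₀ hR₀, hsrange]⟩
  exact
    { eps_pos := hε
      one_le_s := hs
      one_le_k := hk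
      aligned := hR₀.aligned
      anchor_eq := hv1.symm
      norm_anchor := by
        rw [hR₀.anchor_eq, norm_mul, Circle.norm_coe, mul_one, Complex.norm_real,
          Real.norm_of_nonneg (by linarith [H.diam_mem.1])]
      diam_le := hR₀.diam_le
      diam_le_delta := hcomp.diam_le
      start_mem := fun m => by
        obtain ⟨r, hr, he⟩ := hsmem m
        exact (he ▸ hr : start m ∈ H.carrier)
      start_grid := fun m => hgrid (hsmem m)
      start_inj := hstart
      exists_first := hfst
      exists_second := hsnd
      exists_third := by
        obtain ⟨m, hm⟩ := hthd
        exact ⟨m, far, hfar, hm⟩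
      goal_inj := hgoal
      goal_cone := fun i m => by
        have : (rotor s (i + 1) : ℂ) * goal m ∈ component (P : Set ℂ) s (i + 1) := by
          rw [component_eq_image hP (Finset.mem_Icc.2 ⟨by omega, i.2⟩)]
          exact ⟨_, hgQ m, rfl⟩
        exact this.2
      closedBall_subset := hball
      edge_le := hpath.2
      one_le_level := hl1
      level_le := hlk
      tail_le := hl₀.trans (hlk l₀)
      dist_level := fun m => (hlevel m).2.2.1
      lt_dist := fun m => (hlevel m).2.2.2
      dist_tail := fun m hm => hcomp.covTail_subset ((htail m).2 hm)
      exists_tail := hexT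
      head_mem := hhead
      head_ne := hheadne
      scale_pos := by positivity
      scale_le_eps := by
        rw [hμ20]; exact (min_le_right _ _).trans (min_le_left _ _)
      scale_le_diam := by
        rw [hμ20]; exact (min_le_right _ _).trans (min_le_right _ _)
      scale_le_goal := fun b b' hne => by
        rw [hμ20]
        exact ((min_le_left _ _).trans (min_le_left _ _)).trans (hmin₁ (b, b') (dist_pos.2 hne))
      scale_le_path := fun m j _ hj hne => by
        rw [hμ20]
        exact ((min_le_left _ _).trans (min_le_right _ _)).trans
          (hmin₂ (m, ⟨j, Nat.lt_succ_of_le hj⟩) (dist_pos.2 hne)) }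

lemma bijOn_label {ι : Type} {s N : ℕ} {φ : ι → Fin s × Fin N} (hφ : Function.Bijective φ)
    (i : Fin s) (A : Set (Fin N)) {X : ι → ℂ} {g : Fin N → ℂ} (hg : Function.Injective g)
    {D : Set ι} (hD : ∀ r, r ∈ D ↔ (φ r).1 = i ∧ (φ r).2 ∈ A)
    (hX : ∀ r ∈ D, X r = (rotor s (i + 1) : ℂ) * g (φ r).2) :
    Set.BijOn X D ((fun z => (rotor s (i + 1) : ℂ) * z) '' (g '' A)) := by
  refine ⟨?_, ?_, ?_⟩
  · intro r hr
    rw [hX r hr]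
    exact ⟨_, ⟨_, ((hD r).1 hr).2, rfl⟩, rfl⟩
  · intro r hr r' hr' h
    rw [hX r hr, hX r' hr'] at h
    exact hφ.1 (Prod.ext (((hD r).1 hr).1.trans ((hD r').1 hr').1.symm)
      (hg (mul_left_cancel₀ (rotor_ne_zero _ _) h)))
  · rintro _ ⟨_, ⟨m, hm, rfl⟩, rfl⟩
    obtain ⟨r, hr⟩ := hφ.2 (i, m)
    have hrD : r ∈ D := (hD r).2 (by rw [hr]; exact ⟨rfl, hm⟩)
    exact ⟨r, hrD, by rw [hX r hrD, hr]⟩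

/-- A formation is at the vertex with index `j` at time `j - 1`, hence the shifted time in the set
of robots that are not yet dropped. -/
lemma draws_of_tour {P : Finset ℂ} {s : ℕ} (hP : HasRegularPartition (P : Set ℂ) 0 s) {ε δ : ℝ}
    {H : DrawingHull} {N : ℕ} {p : Tour N} (V : p.Valid ε δ s H)
    (htail : p.tail = tailStart δ (component P s 1) p.k p.v)
    (hgoal : Set.range p.goal = component P s 1)
    (hcov : ∀ m, p.goal m ∈ cov δ (component P s 1) p.k p.v (p.level m))
    {ι : Type} {φ : ι → Fin s × Fin N} (hφ : Function.Bijective φ) {X : ℕ → ι → ℂ}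
    (hX : ∀ t ≤ p.k + 1, X t = place s p.pos t ∘ φ) (i : Fin s)
    (hrob : ∀ r, r ∈ (formationHull H s (i + 1)).robots (X 0) ↔ (φ r).1 = i) :
    Draws X (formationHull H s (i + 1)) δ (component P s (i + 1)) p.k
      (fun j => (rotor s (i + 1) : ℂ) * p.v j) (p.k + 1)
      (fun j => {r | (φ r).1 = i ∧ (φ r).2 ∈ p.act (j - 1)}) := by
  have hk := V.one_le_k
  rw [component_eq_image hP (Finset.mem_Icc.2 ⟨by omega, i.2⟩)]
  have hcovj : ∀ j ≤ p.k, cov δ (component P s 1) p.k p.v j = p.goal '' {m | p.level m = j} := by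
    intro j hj
    ext z
    constructor
    · intro hz
      obtain ⟨m, rfl⟩ : z ∈ Set.range p.goal := hgoal ▸ hz.1
      exact ⟨m, cov_index_unique (V.level_le m) hj (hcov m) hz, rfl⟩
    · rintro ⟨m, rfl, rfl⟩
      exact hcov m
  have hcovT : covTail δ (component P s 1) p.k p.v = p.goal '' {m | p.tail ≤ p.level m} := by
    ext z
    constructor
    · intro hz
      obtain ⟨m, rfl⟩ : z ∈ Set.range p.goal := by
        simp only [covTail, Set.mem_iUnion] at hz
        obtain ⟨_, _, h, _⟩ := hz
        exact hgoal ▸ h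
      refine ⟨m, ?_, rfl⟩
      rwa [mem_covTail_iff (V.level_le m) (hcov m), ← htail] at hz
    · rintro ⟨m, hm, rfl⟩
      rwa [mem_covTail_iff (V.level_le m) (hcov m), ← htail]
  -- the robots that are dropped when the formation leaves `v j`
  have hdrop : ∀ j, 1 ≤ j → ∀ m, m ∈ p.act (j - 1) ∧ m ∉ p.act (j + 1 - 1) ↔
      p.level m = j ∧ p.level m < p.tail := by
    intro j hj m
    simp only [Tour.act, Set.mem_ofPred_eq]
    omega
  have hrest : ∀ r t, 1 ≤ t → t ≤ p.k + 1 → p.level (φ r).2 ≤ t → p.level (φ r).2 < p.tail →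
      X t r = (rotor s ((φ r).1 + 1) : ℂ) * p.goal (φ r).2 := by
    intro r t h1 ht hl hl'
    rw [hX t ht, Function.comp_apply, place, p.pos_rest h1]
    simp only [Tour.act, Set.mem_ofPred_eq]
    omega
  have hlast : ∀ r, X (p.k + 1) r = (rotor s ((φ r).1 + 1) : ℂ) * p.goal (φ r).2 := by
    intro r
    rw [hX _ le_rfl, Function.comp_apply, place, p.pos_rest (by omega) (by omega)]
  refine
    { init := ?_
      mem_hull := ?_
      anti := ?_
      drop := ?_
      keep := ?_
      stay := ?_
      last := ?_
      formed := ?_ }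
  · ext r
    rw [hrob]
    refine ⟨fun h => h.1, fun h => ⟨h, Or.inl ?_⟩⟩
    have := V.one_le_level (φ r).2
    omega
  · rintro j hj r ⟨h1, h2⟩
    obtain ⟨hj1, hj2⟩ := Finset.mem_Icc.1 hj
    rw [hX _ (by omega), Function.comp_apply, place, h1, rotor_mul_mem_moveTo]
    have := V.pos_mem_hull (t := j - 1) (by omega) h2
    rwa [Nat.sub_add_cancel hj1] at this
  · rintro j - - r ⟨h1, h2⟩
    exact ⟨h1, p.act_anti (by omega) h2⟩
  · intro j hj1 hj2 hjt
    rw [tailStart_rotor, ← htail] at hjt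
    rw [cov_rotor, hcovj j hj2.le]
    have hD : ∀ r, r ∈ {r | (φ r).1 = i ∧ (φ r).2 ∈ p.act (j - 1)} \
        {r | (φ r).1 = i ∧ (φ r).2 ∈ p.act (j + 1 - 1)} ↔
        (φ r).1 = i ∧ (φ r).2 ∈ {m | p.level m = j} := by
      intro r
      have := hdrop j hj1 (φ r).2
      simp only [Set.mem_sdiff, Set.mem_ofPred_eq, not_and]
      constructor
      · rintro ⟨⟨h1, h2⟩, h3⟩
        exact ⟨h1, (this.1 ⟨h2, h3 h1⟩).1⟩
      · rintro ⟨h1, h2⟩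
        have := this.2 ⟨h2, by omega⟩
        exact ⟨⟨h1, this.1⟩, fun _ => this.2⟩
    refine bijOn_label hφ i _ V.goal_inj hD fun r hr => ?_
    obtain ⟨h1, h2⟩ := (hD r).1 hr
    simp only [Set.mem_ofPred_eq] at h2
    rw [hrest r j hj1 (by omega) h2.le (by omega), h1]
  · intro j hj1 hj2 hjt
    rw [tailStart_rotor, ← htail] at hjt
    ext r
    simp only [Tour.act, Set.mem_ofPred_eq]
    omega
  · rintro j hj1 hj2 r ⟨⟨h1, h2⟩, h3⟩ t hjt ht
    obtain ⟨h4, h5⟩ := (hdrop j hj1 _).1 ⟨h2, fun h => h3 ⟨h1, h⟩⟩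
    rw [hrest r t (by omega) ht (by omega) h5, hrest r j hj1 (by omega) h4.le h5]
  · rw [covTail_rotor, hcovT]
    refine bijOn_label hφ i _ V.goal_inj (fun r => ?_) fun r hr => ?_
    · simp only [Tour.act, Set.mem_ofPred_eq]
      -- A robot still active at time `k - 1` has level `k` or belongs to the tail; by `tail_le` the
      -- former implies the latter.
      have := V.level_le (φ r).2
      have := V.tail_le
      omega
    · rw [hlast, hr.1]
  · rw [← hgoal, ← Set.image_univ]
    refine bijOn_label hφ i _ V.goal_inj (fun r => ?_) fun r hr => ?_
    · rw [hrob]; simp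
    · rw [hlast, (hrob r).1 hr]

end Drawing

/-! ### Assembling the protocol -/

open Drawing in
theorem mainTheorem2 :
    ∃ C : ℕ, ∀ (P : Finset ℂ) (s : ℕ),
      IsEnclosingCenter (P : Set ℂ) 0 → IsSymmetricity (P : Set ℂ) s →
      ∀ (ε : ℝ), 0 < ε → ∀ (e : StateEnum ε) (H : DrawingHull)
        (δ : ℝ) (k : ℕ) (v : ℕ → ℂ),
      IsDrawingPath δ (component P s 1) k v →
      Compatible ε H δ (component P s 1) k v →
      v 1 = H.anchor →
      (∀ j ∈ Finset.Icc 1 k, v j ∈ cone s 1 ∧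
        ∀ y ∈ frontier (cone s 1),
          max ε (H.diam * Real.sin (2 * Real.pi / s)) < dist (v j) y) →
      ∃ (A : Protocol) (T : ℕ), k ≤ T ∧ T ≤ C * k ∧
        ∀ R : Fin P.card → ℂ, IsInitialDrawingPattern e P s H R →
        ∀ u : ℕ → Fin P.card → Circle,
          Set.BijOn (A.run u R T) Set.univ (P : Set ℂ) ∧
          (MindistGt ε (P : Set ℂ) → ∀ t, T ≤ t → A.run u R t = A.run u R T) ∧
          (∀ i ∈ Finset.Icc 1 s, ∃ D : ℕ → Set (Fin P.card),
            Draws (A.run u R) (formationHull H s i) δ (component P s i) k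
              (fun j => (rotor s i : ℂ) * v j) T D) ∧
          NonInterfering (A.run u R) (formationHull H s) s k
            (fun i j => (rotor s i : ℂ) * v j) := by
  -- The running time is k + 1, which is at most 2k because k ≥ 1.
  refine ⟨2, fun P s hcenter hsym ε hε e H δ k v hpath hcomp hv1 hv => ?_⟩
  by_cases hex : ∃ R₀ : Fin P.card → ℂ, IsInitialDrawingPattern e P s H R₀
  swap
  · exact ⟨⟨fun _ => 0, fun _ => by simp⟩, k, le_rfl, by omega, fun R hR => absurd ⟨R, hR⟩ hex⟩
  obtain ⟨R₀, hR₀⟩ := hex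
  obtain ⟨q, hq⟩ : (covTail δ (component P s 1) k v).Nonempty := by
    apply Set.nonempty_of_ncard_ne_zero
    rw [hcomp.covTail_card]; norm_num
  simp only [covTail, Set.mem_iUnion] at hq
  obtain ⟨j₀, -, hq⟩ := hq
  have hP := hsym.hasRegularPartition ⟨q, hq.1.1⟩ hcenter
  have hk : 1 ≤ k := by
    obtain ⟨j, hj, -⟩ := hpath.1 q hq.1
    have := Finset.mem_Icc.1 hj
    omega
  have hball : ∀ j, 1 ≤ j → j ≤ k → Metric.closedBall (v j) ε ⊆ openCone s := fun j h1 h2 =>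
    have h := hv j (Finset.mem_Icc.2 ⟨h1, h2⟩)
    closedBall_subset_openCone hP.1 hε.le h.1 fun y hy => (le_max_left _ _).trans_lt (h.2 y hy)
  obtain ⟨N, p, V, rfl, rfl, htail, hgoal, hcov, hstart⟩ :=
    exists_tour hP hε hpath hcomp hv1 hk hball hR₀
  have hIcc : ∀ i : Fin s, (i : ℕ) + 1 ∈ Finset.Icc 1 s := fun i =>
    Finset.mem_Icc.2 ⟨by omega, i.2⟩
  have hfinal : ∀ t, p.k < t → ∀ b, place s p.pos t b = (rotor s (b.1 + 1) : ℂ) * p.goal b.2 := by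
    intro t ht b
    rw [place, p.pos_rest (by omega) (by omega)]
  have hgoalP : ∀ b : Fin s × _, (rotor s (b.1 + 1) : ℂ) * p.goal b.2 ∈
      component (P : Set ℂ) s (b.1 + 1) := fun b => by
    rw [component_eq_image hP (hIcc b.1), ← hgoal]
    exact ⟨_, ⟨b.2, rfl⟩, rfl⟩
  obtain ⟨A, hA⟩ := V.choreography.exists_protocol (stable := MindistGt ε (P : Set ℂ))
    (fun hmd t ht b b' hne => by
      rw [hfinal t ht, hfinal t ht]
      exact hmd _ (hgoalP b).1 _ (hgoalP b').1 fun h => hne (V.goal_rotor_inj h))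
    (fun t ht m => V.step_le ht m)
  refine ⟨A, p.k + 1, by omega, by omega, fun R hR u => ?_⟩
  have hball0 : Metric.closedBall H.anchor 0 ⊆ openCone s := by
    rw [← hv1]
    exact (Metric.closedBall_subset_closedBall hε.le).trans (hball 1 le_rfl hk)
  obtain ⟨φ, hφ, hRφ, hrob⟩ := hR.exists_labelling (x := p.pos) (by rw [p.pos_zero]; exact V.start_inj)
    (by rw [p.pos_zero]; exact hstart R hR) hball0
  have hrun := hA _ R φ hφ.2 hRφ u
  have hlast : ∀ r, A.run u R (p.k + 1) r = (rotor s ((φ r).1 + 1) : ℂ) * p.goal (φ r).2 := by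
    intro r
    rw [hrun _ (Or.inl le_rfl), Function.comp_apply, hfinal _ (Nat.lt_succ_self _)]
  refine ⟨⟨?_, ?_, ?_⟩, ?_, ?_, ?_⟩
  · intro r _
    rw [hlast]
    exact (hgoalP _).1
  · intro r _ r' _ h
    rw [hlast, hlast] at h
    exact hφ.1 (V.goal_rotor_inj h)
  · intro z hz
    obtain ⟨i, hi, hzi⟩ := exists_mem_cone hP.1 z
    have hzc : z ∈ component (P : Set ℂ) s i := ⟨hz, hzi⟩
    rw [component_eq_image hP hi, ← hgoal] at hzc
    obtain ⟨_, ⟨m, rfl⟩, hm⟩ := hzc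
    obtain ⟨h1, h2⟩ := Finset.mem_Icc.1 hi
    obtain ⟨r, hr⟩ := hφ.2 (⟨i - 1, by omega⟩, m)
    refine ⟨r, Set.mem_univ _, ?_⟩
    rw [hlast, hr]
    simp only [Nat.sub_add_cancel h1]
    exact hm
  · intro hmd t ht
    funext r
    rw [hlast, hrun t (Or.inr hmd), Function.comp_apply, hfinal t (by omega)]
  · intro i hi
    obtain ⟨h1, h2⟩ := Finset.mem_Icc.1 hi
    obtain ⟨i, rfl⟩ : ∃ j : Fin s, i = j + 1 := ⟨⟨i - 1, by omega⟩, by simp; omega⟩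
    exact ⟨_, draws_of_tour hP V htail hgoal hcov hφ (fun t ht => hrun t (Or.inl ht)) i
      fun r => hrob r i⟩
  · intro j hj i hi i' hi' hne
    obtain ⟨hj1, hj2⟩ := Finset.mem_Icc.1 hj
    -- Each hull and all robots of its formation, dropped or not, stay in the cone of that
    -- formation; the cones are disjoint.
    have hsub : ∀ i ∈ Finset.Icc 1 s, ((formationHull H s i).moveTo ((rotor s i : ℂ) * p.v j)).carrier ⊆
        cone s i := fun i hi => hull_subset_cone hi V.aligned hε.le (hball j hj1 hj2)
    refine ⟨Set.disjoint_left.2 fun z hz hz' =>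
      hne (cone_index_unique hi (hsub i hi hz) (hsub i' hi' hz')), fun r hr hr' => ?_⟩
    obtain ⟨h1, h2⟩ := Finset.mem_Icc.1 hi'
    obtain ⟨i', rfl⟩ : ∃ j : Fin s, i' = j + 1 := ⟨⟨i' - 1, by omega⟩, by simp; omega⟩
    have hl : (φ r).1 = i' := (hrob r i').1 hr
    have hc := V.place_mem_cone (j - 1) (φ r)
    rw [hl] at hc
    have hXr : A.run u R (j - 1) r = place s p.pos (j - 1) (φ r) := by
      rw [hrun _ (Or.inl (by omega)), Function.comp_apply]
    rw [hXr] at hr'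
    exact hne (cone_index_unique hi (hsub i hi hr') hc)
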